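/- Let $K$ be a field, $f\in K[x]$ a polynomial of even degree $d$, and $t$ an indeterminate over $K$. Write $f^{\circ n}$ for the $n$-th iterate of $f$ (with $f^{\circ 0}(x)=x$). The preimage graph $T_\infty$ of $t$ has as vertices the roots, in a separable closure $K(t)^{\mathrm{sep}}$ of $K(t)$, of all the polynomials $f^{\circ n}(x)-t$, $n\ge 0$; two vertices $\alpha\neq\beta$ are joined by an edge when $f(\alpha)=\beta$ or $f(\beta)=\alpha$. The action of $\mathrm{Gal}(K(t)^{\mathrm{sep}}/K(t))$ on the vertices defines the arboreal representation $\phi:\mathrm{Gal}(K(t)^{\mathrm{sep}}/K(t))\to\mathrm{Aut}(T_\infty)$, whose image is called the iterated monodromy group of $f$. Let $\Gamma$ be the multiset of roots of $f'$ (with multiplicity) in an algebraic closure $\overline K$ of $K$, let $\Gamma_n=f^{\circ n}(\Gamma)$ as a multiset, and let $\Gamma_n'$ be the set of elements whose multiplicity in $\Gamma_n$ is odd. The polynomial $f$ is called post-critically finite if every $\gamma\in\Gamma$ has a finite orbit under $f$. Assume that the Galois group of the splitting field of $f(x)-t$ over $K(t)$ is isomorphic to $A_d$ or $S_d$. 1.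 Suppose that for every $n\ge 1$ the set $\Gamma_n'$ is not contained in $\bigcup_{1\le i<n}\Gamma_i'$. Then the polynomials $f^{\circ n}(x)-t$, $n\ge0$, are separable, $t$ is not periodic under $f$ (so $T_\infty$ is a complete rooted $d$-ary tree), and the iterated monodromy group of $f$ is all of $\mathrm{Aut}(T_\infty)$. 2. Suppose that $f$ has coefficients in a field $k$ of which $K$ is an extension, that $f'$ is irreducible over $k$ and of odd degree (the degree is $d-1$, hence odd, whenever the characteristic of $K$ does not divide $d$), and that $f$ is not post-critically finite. Then the same conclusion holds. In particular, taking $K=\overline k$: if $f\in k[x]$ has even degree $d$, the Galois group of $f(x)-t$ over $\overline k(t)$ is $A_d$ or $S_d$, $f'$ is irreducible over $k$ of odd degree, and $f$ is not post-critically finite, then the iterated monodromy group of $f$ over $\overline k(t)$ is all of $\mathrm{Aut}(T_\infty)$. -/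

import Mathlib

open Polynomial

noncomputable section

/-- The self-map `x ↦ f(x)` of an extension `L` of `F` given by a polynomial `f ∈ F[x]`. -/
def polyMap {F : Type*} [Field F] (L : Type*) [Field L] [Algebra F L] (f : F[X]) : L → L :=
  fun x => aeval x f

/-- The `n`-th iterate `f ∘ f ∘ ⋯ ∘ f` as a polynomial; the `0`-th iterate is `x`. -/
def iteratePoly {F : Type*} [Field F] (f : F[X]) (n : ℕ) : F[X] :=
  f.comp^[n] X

/-- The set of all roots in `L` of the polynomials `f^{∘n}(x) - t`, `n ≥ 0`. -/
def preimageSet {F : Type*} [Field F] (L : Type*) [Field L] [Algebra F L]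
    (f : F[X]) (t : F) : Set L :=
  {α | ∃ n : ℕ, aeval α (iteratePoly f n - C t) = 0}

/-- The preimage graph of `t` under `f`: its vertices are the roots of all `f^{∘n}(x) - t`, and
two vertices `α ≠ β` are joined by an edge when `f(α) = β` or `f(β) = α`. -/
def preimageTree {F : Type*} [Field F] (L : Type*) [Field L] [Algebra F L]
    (f : F[X]) (t : F) : SimpleGraph (preimageSet L f t) :=
  SimpleGraph.fromRel fun α β => polyMap L f α = β

theorem polyMap_algEquiv {F : Type*} [Field F] {L : Type*} [Field L] [Algebra F L]
    (f : F[X]) (σ : L ≃ₐ[F] L) (x : L) : polyMap L f (σ x) = σ (polyMap L f x) :=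
  aeval_algHom_apply σ x f

theorem preimageSet_algEquiv {F : Type*} [Field F] {L : Type*} [Field L] [Algebra F L]
    (f : F[X]) (t : F) (σ : L ≃ₐ[F] L) {x : L} (hx : x ∈ preimageSet L f t) :
    σ x ∈ preimageSet L f t := by
  obtain ⟨n, hn⟩ := hx
  exact ⟨n, by rw [aeval_algHom_apply σ x, hn, map_zero]⟩

/-- The automorphism of the preimage graph induced by `σ ∈ Aut(L/F)`. -/
def galTreeAut {F : Type*} [Field F] {L : Type*} [Field L] [Algebra F L]
    (f : F[X]) (t : F) (σ : L ≃ₐ[F] L) : preimageTree L f t ≃g preimageTree L f t where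
  toFun α := ⟨σ α, preimageSet_algEquiv f t σ α.2⟩
  invFun α := ⟨σ.symm α, preimageSet_algEquiv f t σ.symm α.2⟩
  left_inv α := Subtype.ext (σ.symm_apply_apply α)
  right_inv α := Subtype.ext (σ.apply_symm_apply α)
  map_rel_iff' := by
    intro α β
    simp [preimageTree, polyMap_algEquiv, Subtype.ext_iff]

/-- The arboreal Galois representation attached to `f` and `t`, for `L` a separable closure
of `F`: the Galois action on the preimage graph. -/
def arborealRep {F : Type*} [Field F] (L : Type*) [Field L] [Algebra F L]
    (f : F[X]) (t : F) : (L ≃ₐ[F] L) →* (preimageTree L f t ≃g preimageTree L f t) where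
  toFun σ := galTreeAut f t σ
  map_one' := rfl
  map_mul' _ _ := rfl

/-- A polynomial `f ∈ K[x]` viewed as a polynomial over the rational function field `K(t)`. -/
def overRatFunc {K : Type*} [Field K] (f : K[X]) : (RatFunc K)[X] :=
  f.map (algebraMap K (RatFunc K))

/-- The preimage tree `T_∞` of the indeterminate `t` under `f`, in a separable closure
of `K(t)`. -/
def monodromyTree {K : Type*} [Field K] (f : K[X]) :
    SimpleGraph (preimageSet (SeparableClosure (RatFunc K)) (overRatFunc f) RatFunc.X) :=
  preimageTree (SeparableClosure (RatFunc K)) (overRatFunc f) RatFunc.X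

/-- The iterated monodromy group of `f`: the image in `Aut(T_∞)` of the arboreal representation
attached to `f` and `t` over `K(t)`. -/
def iteratedMonodromyGroup {K : Type*} [Field K] (f : K[X]) :
    Subgroup (monodromyTree f ≃g monodromyTree f) :=
  (arborealRep (SeparableClosure (RatFunc K)) (overRatFunc f) RatFunc.X).range

/-- The iterated monodromy group is maximal: the representation is attached to a genuine complete
`d`-ary tree (all `f^{∘n}(x) - t` are separable over `K(t)` and `t` is not periodic under `f`), and
its image is all of `Aut(T_∞)`. -/
def HasMaximalMonodromy {K : Type*} [Field K] (f : K[X]) : Prop :=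
  (∀ n : ℕ, (iteratePoly (overRatFunc f) n - C RatFunc.X).Separable) ∧
  (∀ n : ℕ, 1 ≤ n → (iteratePoly (overRatFunc f) n).eval RatFunc.X ≠ RatFunc.X) ∧
  iteratedMonodromyGroup f = ⊤

/-- The Galois group of the splitting field of `f(x) - t` over `K(t)` is `A_d` or `S_d`,
where `d = deg f`. -/
def HasAltOrSymGaloisGroup {K : Type*} [Field K] (f : K[X]) : Prop :=
  Nonempty ((overRatFunc f - C RatFunc.X).Gal ≃* alternatingGroup (Fin f.natDegree)) ∨
  Nonempty ((overRatFunc f - C RatFunc.X).Gal ≃* Equiv.Perm (Fin f.natDegree))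

/-- The multiset `Γ` of roots of `f'`, with multiplicity, in an algebraic closure of `K`. -/
def criticalPoints {K : Type*} [Field K] (f : K[X]) : Multiset (AlgebraicClosure K) :=
  (derivative f).aroots (AlgebraicClosure K)

/-- The multiset `Γ_n = f^{∘n}(Γ)`. -/
def criticalImage {K : Type*} [Field K] (f : K[X]) (n : ℕ) : Multiset (AlgebraicClosure K) :=
  (criticalPoints f).map (polyMap (AlgebraicClosure K) f)^[n]

open Classical in
/-- The set `Γ'_n` of elements that have odd multiplicity in `Γ_n`. -/
def oddCriticalImage {K : Type*} [Field K] (f : K[X]) (n : ℕ) : Set (AlgebraicClosure K) :=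
  {γ | Odd ((criticalImage f n).count γ)}

/-- `f` is post-critically finite if every root of `f'` has a finite orbit under `f`. -/
def IsPostCriticallyFinite {K : Type*} [Field K] (f : K[X]) : Prop :=
  ∀ γ ∈ criticalPoints f,
    (Set.range fun n : ℕ => (polyMap (AlgebraicClosure K) f)^[n] γ).Finite

end

noncomputable section

/-! Let `G` be the Galois group and `Stab_n` the subgroup fixing level `n` of the tree pointwise. By
compactness of `G`, the image of `G` is all of `Aut(T_∞)` as soon as, for every `n`, `Stab_n` maps
onto the product of the symmetric groups of the fibers over level `n` (`fiberPerm`,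
`arborealRep_range_eq_top`).

Signs are the only obstruction to this surjectivity: a subgroup of a product of symmetric groups
that projects onto each factor is everything unless some nontrivial product of signs vanishes on it
(`eq_top_of_signProd_ne`). The exponent vectors of the vanishing products form a `G`-stable subspace
of `F_2^{level n}`. Since `d` is even and the lower levels are already full, a nonzero such subspace
contains the all-ones vector (`vanishing_one`), so the sign of the action on level `n + 1` would be
trivial on `Stab_n`, hence a product of signs of lower levels (`exists_eq_prod_levelSign`). Only
relations between level signs have to be excluded.

The sign on level `n + 1` describes the action on a square root of the discriminant of
`f^{∘(n+1)}(x) - t`. As `d` is even, the chain rule shows that, up to constants and squares of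
invariant elements, this discriminant is the product of `f'(z)` over level `n + 1`, that is, of `t -
b` over `b ∈ Γ_{n+1}`. A point of `Γ'_{n+1}` outside the earlier `Γ'_i` is a zero of odd order of
any putative relation, which therefore cannot be a square in `K(t)` (`prod_levelSign_ne`).
Projection onto each factor comes from the hypothesis on `f(x) - t`: a vertex `α` is transcendental
over `K`, so `K(α)` is a copy of `K(t)`, and all even permutations of the fiber over `α` occur
(`exists_algEquiv_alternating`).

If `f'` is irreducible over `k` of odd degree, conjugation makes all multiplicities in `Γ_n` equal,
hence odd. Failure of the criterion at one `n` then puts `f^{∘n}(Γ)` inside the union of the earlier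
images of `Γ`, so `f` is post-critically finite. -/

/-! ### Subgroups of products of symmetric groups, and signs. -/

/-- Commutators with transpositions yield a 3-cycle unless `σ` is itself a transposition, whose
conjugates generate. This covers all degrees, including degree 4, where the Klein four-group is
normal but even. -/
theorem Equiv.Perm.eq_top_of_odd_mem_normal {α : Type*} [Fintype α] [DecidableEq α]
    (N : Subgroup (Equiv.Perm α)) (hN : N.Normal) (σ : Equiv.Perm α) (hσ : σ ∈ N)
    (hodd : Equiv.Perm.sign σ ≠ 1) : N = ⊤ := by
  have hconj {a b : Equiv.Perm α} (ha : a ∈ N) (h : IsConj a b) : b ∈ N := by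
    obtain ⟨c, rfl⟩ := isConj_iff.1 h
    exact hN.conj_mem a ha c
  have of_three {τ : Equiv.Perm α} (hτ : τ ∈ N) (h3 : τ.IsThreeCycle) : N = ⊤ := by
    have hA : alternatingGroup α ≤ N := by
      rw [← Equiv.Perm.closure_three_cycles_eq_alternating, Subgroup.closure_le]
      intro ρ hρ
      exact hconj hτ (Equiv.Perm.isConj_iff_cycleType_eq.2 (h3.cycleType.trans hρ.cycleType.symm))
    rw [eq_top_iff]
    intro ρ _
    rcases Int.units_eq_one_or (Equiv.Perm.sign ρ) with h | h
    · exact hA (Equiv.Perm.mem_alternatingGroup.2 h)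
    · have : ρ * σ ∈ N := hA (Equiv.Perm.mem_alternatingGroup.2 (by
        rw [map_mul, h, (Int.units_eq_one_or _).resolve_left hodd]; rfl))
      simpa using N.mul_mem this (N.inv_mem hσ)
  -- This is the commutator of `σ` with `swap a b`.
  have comm_mem (a b : α) : Equiv.swap (σ a) (σ b) * Equiv.swap a b ∈ N := by
    have h1 := N.mul_mem hσ (hN.conj_mem _ (N.inv_mem hσ) (Equiv.swap a b))
    have h2 : σ * (Equiv.swap a b * σ⁻¹ * (Equiv.swap a b)⁻¹) =
        Equiv.swap (σ a) (σ b) * Equiv.swap a b := by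
      rw [Equiv.swap_inv, ← mul_assoc, ← mul_assoc, Equiv.mul_swap_eq_swap_mul σ a b,
        mul_assoc _ σ, mul_inv_cancel, mul_one]
    rwa [h2] at h1
  by_cases hinv : ∃ a, σ a ≠ a ∧ σ (σ a) ≠ a
  · obtain ⟨a, h1, h2⟩ := hinv
    refine of_three (comm_mem a (σ a)) ?_
    rw [Equiv.swap_comm a]
    exact Equiv.Perm.isThreeCycle_swap_mul_swap_same (fun h => h1 (σ.injective h).symm) h1 h2
  push Not at hinv
  have hinv' (a : α) : σ (σ a) = a := by
    by_cases h : σ a = a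
    · rw [h, h]
    · exact hinv a h
  obtain ⟨a, ha⟩ : ∃ a, σ a ≠ a := by
    by_contra! h
    exact hodd (by rw [show σ = 1 from Equiv.ext h]; simp)
  by_cases hb : ∃ b, σ b ≠ b ∧ b ≠ a ∧ b ≠ σ a
  · obtain ⟨b, hb, hba, hbσ⟩ := hb
    have hσba : σ b ≠ a := fun h => hbσ (by rw [← h, hinv'])
    have hσbσ : σ b ≠ σ a := fun h => hba (σ.injective h)
    -- A fifth point turns the double transposition into a 3-cycle by one more commutator. Without
    -- it, `σ` is a product of two disjoint transpositions, hence even.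
    by_cases hc : ∃ c, c ≠ a ∧ c ≠ b ∧ c ≠ σ a ∧ c ≠ σ b
    · obtain ⟨c, hca, hcb, hcσa, hcσb⟩ := hc
      have h1 := comm_mem a b
      have h2 := hN.conj_mem _ h1 (Equiv.swap b c)
      have h3 := N.mul_mem (N.inv_mem h1) h2
      have key : (Equiv.swap (σ a) (σ b) * Equiv.swap a b)⁻¹ * (Equiv.swap b c *
          (Equiv.swap (σ a) (σ b) * Equiv.swap a b) * (Equiv.swap b c)⁻¹) =
          Equiv.swap a b * Equiv.swap a c := by
        have e1 : Equiv.swap b c * Equiv.swap (σ a) (σ b) =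
            Equiv.swap (σ a) (σ b) * Equiv.swap b c := by
          rw [Equiv.mul_swap_eq_swap_mul, Equiv.swap_apply_of_ne_of_ne hbσ.symm hcσa.symm,
            Equiv.swap_apply_of_ne_of_ne hb hcσb.symm]
        have e2 : Equiv.swap b c * Equiv.swap a b = Equiv.swap a c * Equiv.swap b c := by
          rw [Equiv.mul_swap_eq_swap_mul, Equiv.swap_apply_of_ne_of_ne hba.symm hca.symm,
            Equiv.swap_apply_left]
        rw [mul_inv_rev, Equiv.swap_inv, Equiv.swap_inv, Equiv.swap_inv, ← mul_assoc (Equiv.swap b c),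
          e1, mul_assoc (Equiv.swap (σ a) (σ b)) (Equiv.swap b c), e2]
        simp [mul_assoc]
      rw [key] at h3
      exact of_three h3 (Equiv.Perm.isThreeCycle_swap_mul_swap_same hba.symm hca.symm hcb.symm)
    · exfalso
      push Not at hc
      apply hodd
      have : σ = Equiv.swap a (σ a) * Equiv.swap b (σ b) := by
        ext x
        rw [Equiv.Perm.mul_apply]
        by_cases hxa : x = a
        · subst hxa
          rw [Equiv.swap_apply_of_ne_of_ne hba.symm hσba.symm, Equiv.swap_apply_left]
        by_cases hxb : x = b
        · subst hxb
          rw [Equiv.swap_apply_left, Equiv.swap_apply_of_ne_of_ne hσba hσbσ]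
        by_cases hxσ : x = σ a
        · subst hxσ
          rw [Equiv.swap_apply_of_ne_of_ne hxb hσbσ.symm, Equiv.swap_apply_right, hinv']
        · rw [hc x hxa hxb hxσ, hinv', Equiv.swap_apply_right,
            Equiv.swap_apply_of_ne_of_ne hba hbσ]
      rw [this, map_mul, Equiv.Perm.sign_swap ha.symm, Equiv.Perm.sign_swap hb.symm]
      rfl
  · push Not at hb
    have hs : σ = Equiv.swap a (σ a) := by
      ext x
      by_cases hxa : x = a
      · subst hxa; rw [Equiv.swap_apply_left]
      by_cases hxσ : x = σ a
      · subst hxσ; rw [Equiv.swap_apply_right, hinv']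
      · rw [Equiv.swap_apply_of_ne_of_ne hxa hxσ]
        by_contra h
        exact hxσ (hb x h hxa)
    rw [eq_top_iff, ← Equiv.Perm.closure_isSwap, Subgroup.closure_le]
    rintro _ ⟨x, y, hxy, rfl⟩
    rw [hs] at hσ
    exact hconj hσ (Equiv.Perm.isConj_swap ha.symm hxy)

theorem MonoidHom.pi_group_ext {ι M : Type*} [Finite ι] [DecidableEq ι] {P : ι → Type*}
    [∀ i, Group (P i)] [Monoid M] {g h : (∀ i, P i) →* M}
    (H : ∀ i (p : P i), g (Pi.mulSingle i p) = h (Pi.mulSingle i p)) : g = h :=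
  MonoidHom.ext fun x =>
    Subgroup.pi_mem_of_mulSingle_mem (H := g.eqLocus h) x fun i => H i (x i)

/-- The product of the signs of the components indexed by `w`. -/
def signProd {ι : Type*} [Fintype ι] {X : ι → Type*} [∀ i, Fintype (X i)]
    [∀ i, DecidableEq (X i)] (w : ι → ZMod 2) : (∀ i, Equiv.Perm (X i)) →* ℤˣ where
  toFun x := ∏ i, Equiv.Perm.sign (x i) ^ w i
  map_one' := by simp
  map_mul' x y := by simp [mul_uzpow, Finset.prod_mul_distrib]

theorem signProd_add {ι : Type*} [Fintype ι] {X : ι → Type*} [∀ i, Fintype (X i)]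
    [∀ i, DecidableEq (X i)] (v w : ι → ZMod 2) (x : ∀ i, Equiv.Perm (X i)) :
    signProd (v + w) x = signProd v x * signProd w x := by
  simp [signProd, uzpow_add, Finset.prod_mul_distrib]

theorem signProd_mulSingle {ι : Type*} [Fintype ι] [DecidableEq ι] {X : ι → Type*}
    [∀ i, Fintype (X i)] [∀ i, DecidableEq (X i)] (w : ι → ZMod 2) (i : ι)
    (p : Equiv.Perm (X i)) :
    signProd w (Pi.mulSingle i p) = Equiv.Perm.sign p ^ w i := by
  simp only [signProd, MonoidHom.coe_mk, OneHom.coe_mk]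
  rw [Finset.prod_eq_single i]
  · simp
  · intro j _ hj
    rw [Pi.mulSingle_eq_of_ne hj]
    simp
  · simp

theorem Equiv.Perm.hom_units_eq_sign_pow {α : Type*} [Fintype α] [DecidableEq α]
    (χ : Equiv.Perm α →* ℤˣ) : ∃ e : ZMod 2, ∀ p, χ p = Equiv.Perm.sign p ^ e := by
  by_cases h : Function.Surjective χ
  · exact ⟨1, fun p => by rw [Equiv.Perm.eq_sign_of_surjective_hom h, uzpow_one]⟩
  · refine ⟨0, fun p => ?_⟩
    rw [uzpow_zero]
    by_contra hp
    refine h fun u => ?_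
    rcases Int.units_eq_one_or u with rfl | rfl
    · exact ⟨1, map_one _⟩
    · exact ⟨p, (Int.units_eq_one_or _).resolve_left hp⟩

theorem exists_eq_signProd {ι : Type*} [Fintype ι] {X : ι → Type*} [∀ i, Fintype (X i)]
    [∀ i, DecidableEq (X i)] (χ : (∀ i, Equiv.Perm (X i)) →* ℤˣ) :
    ∃ w : ι → ZMod 2, χ = signProd w := by
  classical
  choose w hw using fun i => Equiv.Perm.hom_units_eq_sign_pow
    (χ.comp (MonoidHom.mulSingle (fun i => Equiv.Perm (X i)) i))
  refine ⟨w, MonoidHom.pi_group_ext fun i p => ?_⟩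
  rw [signProd_mulSingle, ← hw]
  rfl

/-- A subgroup of a product of symmetric groups which projects onto every factor and on which no
nontrivial product of signs vanishes is the whole product. -/
theorem eq_top_of_signProd_ne {ι : Type*} [Fintype ι] {X : ι → Type*} [∀ i, Fintype (X i)]
    [∀ i, DecidableEq (X i)] (H : Subgroup (∀ i, Equiv.Perm (X i)))
    (hproj : ∀ i (p : Equiv.Perm (X i)), ∃ h ∈ H, h i = p)
    (hsign : ∀ w : ι → ZMod 2, (∀ h ∈ H, signProd w h = 1) → w = 0) : H = ⊤ := by
  classical
  suffices ∀ (s : Finset ι) (x : ∀ i, Equiv.Perm (X i)), ∃ h ∈ H, ∀ i ∈ s, h i = x i by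
    rw [eq_top_iff]
    intro x _
    obtain ⟨h, hH, hx⟩ := this Finset.univ x
    rwa [show x = h from funext fun i => (hx i (Finset.mem_univ i)).symm]
  intro s
  induction s using Finset.induction_on with
  | empty => exact fun x => ⟨1, H.one_mem, by simp⟩
  | insert i s his ih =>
  -- `R` measures the freedom left in coordinate `i` once the coordinates in `s` are prescribed, as
  -- in Goursat's lemma. It is normal because `H` projects onto factor `i`.
  let R : Subgroup (Equiv.Perm (X i)) :=
    { carrier := {p | ∃ h ∈ H, (∀ j ∈ s, h j = 1) ∧ h i = p}
      one_mem' := ⟨1, H.one_mem, by simp, rfl⟩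
      mul_mem' := by
        rintro _ _ ⟨h, hH, h1, rfl⟩ ⟨k, kH, k1, rfl⟩
        exact ⟨h * k, H.mul_mem hH kH, fun j hj => by simp [h1 j hj, k1 j hj], rfl⟩
      inv_mem' := by
        rintro _ ⟨h, hH, h1, rfl⟩
        exact ⟨h⁻¹, H.inv_mem hH, fun j hj => by simp [h1 j hj], rfl⟩ }
  have hR : R.Normal := by
    refine ⟨?_⟩
    rintro _ ⟨h, hH, h1, rfl⟩ q
    obtain ⟨k, kH, rfl⟩ := hproj i q
    exact ⟨k * h * k⁻¹, H.mul_mem (H.mul_mem kH hH) (H.inv_mem kH),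
      fun j hj => by simp [h1 j hj], rfl⟩
  by_cases hodd : ∃ p ∈ R, Equiv.Perm.sign p ≠ 1
  · obtain ⟨p, hp, hp1⟩ := hodd
    have hRtop := Equiv.Perm.eq_top_of_odd_mem_normal R hR p hp hp1
    intro x
    obtain ⟨h, hH, hx⟩ := ih x
    obtain ⟨k, kH, k1, ki⟩ : (h i)⁻¹ * x i ∈ R := hRtop ▸ Subgroup.mem_top _
    refine ⟨h * k, H.mul_mem hH kH, fun j hj => ?_⟩
    rcases Finset.mem_insert.1 hj with rfl | hj
    · simp [ki]
    · simp [k1 j hj, hx j hj]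
  -- Now the sign of coordinate `i` on `H` depends only on the coordinates in `s`. It is thus a
  -- character `χ` of the full product, a product of signs `w` with `w i = 0`, and `w + e_i`
  -- vanishes on `H`.
  · exfalso
    push Not at hodd
    choose φ hφH hφ using ih
    have hwd {h k : ∀ i, Equiv.Perm (X i)} (hH : h ∈ H) (kH : k ∈ H)
        (hhk : ∀ j ∈ s, h j = k j) : Equiv.Perm.sign (h i) = Equiv.Perm.sign (k i) := by
      have := hodd (h i * (k i)⁻¹) ⟨h * k⁻¹, H.mul_mem hH (H.inv_mem kH),
        fun j hj => by simp [hhk j hj], rfl⟩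
      rwa [map_mul, map_inv, mul_inv_eq_one] at this
    let χ : (∀ i, Equiv.Perm (X i)) →* ℤˣ :=
      { toFun := fun x => Equiv.Perm.sign (φ x i)
        map_one' := by
          have := hwd (hφH 1) H.one_mem (hφ 1)
          simpa using this
        map_mul' := fun x y => by
          have := hwd (hφH (x * y)) (H.mul_mem (hφH x) (hφH y))
            (fun j hj => by simp [hφ _ j hj])
          simpa using this }
    have hχs (x : ∀ i, Equiv.Perm (X i)) (y : ∀ i, Equiv.Perm (X i))
        (hxy : ∀ j ∈ s, x j = y j) : χ x = χ y :=
      hwd (hφH x) (hφH y) fun j hj => by rw [hφ x j hj, hφ y j hj, hxy j hj]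
    obtain ⟨w, hw⟩ := exists_eq_signProd χ
    have hχi (p : Equiv.Perm (X i)) : χ (Pi.mulSingle i p) = 1 := by
      rw [hχs _ 1, map_one]
      intro j hj
      rw [Pi.mulSingle_eq_of_ne (by rintro rfl; exact his hj)]
      rfl
    by_cases htriv : ∃ p : Equiv.Perm (X i), Equiv.Perm.sign p ≠ 1
    · have hwi : w i = 0 := by
        obtain ⟨p, hp⟩ := htriv
        have h1 := hχi p
        rw [hw, signProd_mulSingle] at h1
        by_contra hne
        rw [show w i = 1 from Fin.eq_one_of_ne_zero _ hne, uzpow_one] at h1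
        exact hp h1
      have h0 := hsign (w + Pi.single i 1) fun h hH => by
        rw [signProd_add, ← hw]
        have e1 : χ h = Equiv.Perm.sign (h i) := hwd (hφH h) hH (hφ h)
        have e2 : signProd (Pi.single i 1) h = Equiv.Perm.sign (h i) := by
          simp only [signProd, MonoidHom.coe_mk, OneHom.coe_mk]
          rw [Finset.prod_eq_single i]
          · simp
          · intro j _ hj
            simp [hj]
          · simp
        rw [e1, e2, Int.units_mul_self]
      have := congrFun h0 i
      simp [hwi] at this
    -- If `X i` has no odd permutation, `w i` is undetermined, but `e_i` itself gives a vanishing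
    -- product.
    · push Not at htriv
      have h0 := hsign (Pi.single i 1) fun h hH => by
        simp only [signProd, MonoidHom.coe_mk, OneHom.coe_mk]
        refine Finset.prod_eq_one fun j _ => ?_
        by_cases hj : j = i
        · subst hj; simp [htriv]
        · simp [hj]
      have := congrFun h0 i
      simp at this

/-- Both sides are characters of the product, so a single transposition in a single factor decides.
-/
theorem Equiv.Perm.sign_sigmaCongrRight_eq_prod {ι : Type*} [Fintype ι] [DecidableEq ι]
    {X : ι → Type*} [∀ i, Fintype (X i)] [∀ i, DecidableEq (X i)]
    (x : ∀ i, Equiv.Perm (X i)) :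
    Equiv.Perm.sign (Equiv.Perm.sigmaCongrRight x) = ∏ i, Equiv.Perm.sign (x i) := by
  have h : Equiv.Perm.sign.comp (Equiv.Perm.sigmaCongrRightHom X) = signProd (fun _ => 1) := by
    refine MonoidHom.pi_group_ext fun i p => ?_
    rw [signProd_mulSingle, uzpow_one]
    induction p using Equiv.Perm.swap_induction_on with
    | one => simp
    | swap_mul p a b hab ih =>
      rw [Pi.mulSingle_mul, map_mul, ih, map_mul, Equiv.Perm.sign_swap hab]
      congr 1
      have : Equiv.Perm.sigmaCongrRightHom X (Pi.mulSingle i (Equiv.swap a b)) =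
          Equiv.swap (⟨i, a⟩ : Σ i, X i) ⟨i, b⟩ := by
        ext1 ⟨j, c⟩
        change (⟨j, (Pi.mulSingle i (Equiv.swap a b) : ∀ i, Equiv.Perm (X i)) j c⟩ : Σ i, X i) = _
        by_cases hj : j = i
        · subst hj
          simp only [Pi.mulSingle_eq_same, Equiv.swap_apply_def, Sigma.mk.injEq, heq_eq_eq,
            true_and]
          split_ifs <;> rfl
        · rw [Equiv.swap_apply_of_ne_of_ne] <;>
            simp [Pi.mulSingle_eq_of_ne, hj]
      rw [MonoidHom.comp_apply, this, Equiv.Perm.sign_swap]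
      simpa using hab
  have := DFunLike.congr_fun h x
  simpa [signProd] using this

/-! ### Group actions on regular rooted trees of even degree. -/

/-- The vertices at distance `n` from the root in the preimage tree of `t` under `φ`. -/
def treeLevel {V : Type*} (φ : V → V) (t : V) (n : ℕ) : Set V := {x | φ^[n] x = t}

/-- The children of a vertex. -/
abbrev TreeFiber {V : Type*} (φ : V → V) (α : V) : Type _ := {y : V // φ y = α}

/-- `G` acts on the preimage tree of `t` under `φ`, all of whose vertices have `d` children,
with `d` even and positive. -/
structure RegularTreeAction (G : Type*) {V : Type*} [Group G] [MulAction G V] (φ : V → V) (t : V)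
    (d : ℕ) : Prop where
  map_smul : ∀ (g : G) x, φ (g • x) = g • φ x
  smul_root : ∀ g : G, g • t = t
  even : Even d
  pos : 0 < d
  card_fiber : ∀ n, ∀ α ∈ treeLevel φ t n, Nat.card (TreeFiber φ α) = d

namespace RegularTreeAction

variable {G V : Type*} [Group G] [MulAction G V] {φ : V → V} {t : V} {d : ℕ}

theorem iterate_smul (h : RegularTreeAction G φ t d) (n : ℕ) (g : G) (x : V) :
    φ^[n] (g • x) = g • φ^[n] x :=
  ((show Function.Semiconj (g • ·) φ φ from fun x => (h.map_smul g x).symm).iterate_right n x).symm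

theorem smul_mem_treeLevel (h : RegularTreeAction G φ t d) {n : ℕ} (g : G) {x : V}
    (hx : x ∈ treeLevel φ t n) : g • x ∈ treeLevel φ t n := by
  rw [treeLevel, Set.mem_ofPred_eq, h.iterate_smul, show φ^[n] x = t from hx, h.smul_root]

theorem iterate_mem_treeLevel {j k n : ℕ} (hn : j + k = n) {x : V} (hx : x ∈ treeLevel φ t n) :
    φ^[k] x ∈ treeLevel φ t j := by
  subst hn
  rwa [treeLevel, Set.mem_ofPred_eq, ← Function.iterate_add_apply]

theorem mem_treeLevel_succ {n : ℕ} {x : V} :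
    x ∈ treeLevel φ t (n + 1) ↔ φ x ∈ treeLevel φ t n := Iff.rfl

theorem fiber_mem {n : ℕ} {α : V} (hα : α ∈ treeLevel φ t n) (y : TreeFiber φ α) :
    (y : V) ∈ treeLevel φ t (n + 1) :=
  mem_treeLevel_succ.2 (y.2.symm ▸ hα)

/-- Level `n + 1` is the disjoint union of the fibers over level `n`. -/
def treeLevelSuccEquiv (n : ℕ) :
    (Σ α : treeLevel φ t n, TreeFiber φ (α : V)) ≃ treeLevel φ t (n + 1) where
  toFun y := ⟨y.2, fiber_mem y.1.2 y.2⟩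
  invFun y := ⟨⟨φ y, y.2⟩, ⟨y, rfl⟩⟩
  left_inv := by
    rintro ⟨⟨α, hα⟩, ⟨y, hy⟩⟩
    obtain rfl : φ y = α := hy
    rfl
  right_inv _ := rfl

theorem nontrivial_fiber (h : RegularTreeAction G φ t d) {n : ℕ} {α : V}
    (hα : α ∈ treeLevel φ t n) : Nontrivial (TreeFiber φ α) := by
  have h1 := h.card_fiber n α hα
  have h2 : 1 < Nat.card (TreeFiber φ α) := by
    obtain ⟨k, hk⟩ := h.even
    have := h.pos
    omega
  have := Nat.finite_of_card_ne_zero (α := TreeFiber φ α) (by omega)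
  exact Finite.one_lt_card_iff_nontrivial.1 h2

theorem exists_mem_treeLevel (h : RegularTreeAction G φ t d) (n : ℕ) :
    ∃ x, x ∈ treeLevel φ t n := by
  induction n with
  | zero => exact ⟨t, rfl⟩
  | succ n ih =>
    obtain ⟨x, hx⟩ := ih
    obtain ⟨y⟩ := (h.nontrivial_fiber hx).to_nonempty
    exact ⟨y, fiber_mem hx y⟩

/-- The permutation action on a level of the tree. -/
def levelPerm (h : RegularTreeAction G φ t d) (n : ℕ) : G →* Equiv.Perm (treeLevel φ t n) where
  toFun g :=
    { toFun := fun x => ⟨g • (x : V), h.smul_mem_treeLevel g x.2⟩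
      invFun := fun x => ⟨g⁻¹ • (x : V), h.smul_mem_treeLevel g⁻¹ x.2⟩
      left_inv := fun x => Subtype.ext (inv_smul_smul g (x : V))
      right_inv := fun x => Subtype.ext (smul_inv_smul g (x : V)) }
  map_one' := by ext x; simp
  map_mul' g g' := by ext x; simp [mul_smul]

@[simp]
theorem coe_levelPerm (h : RegularTreeAction G φ t d) (n : ℕ) (g : G) (x : treeLevel φ t n) :
    (h.levelPerm n g x : V) = g • (x : V) := rfl

/-- The subgroup acting trivially on a level of the tree. -/
abbrev levelStab (_h : RegularTreeAction G φ t d) (n : ℕ) : Subgroup G :=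
  fixingSubgroup G (treeLevel φ t n)

theorem smul_eq (h : RegularTreeAction G φ t d) {n : ℕ} (x : h.levelStab n) {α : V}
    (hα : α ∈ treeLevel φ t n) : (x : G) • α = α :=
  (mem_fixingSubgroup_iff G).1 x.2 α hα

theorem conj_mem (h : RegularTreeAction G φ t d) {n : ℕ} (g : G) {x : G}
    (hx : x ∈ h.levelStab n) : g * x * g⁻¹ ∈ h.levelStab n := by
  rw [mem_fixingSubgroup_iff] at hx ⊢
  intro y hy
  rw [mul_smul, mul_smul, hx _ (h.smul_mem_treeLevel g⁻¹ hy), smul_inv_smul]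

/-- The action of the elements fixing a level on the children of the vertices of that level. -/
def fiberPerm (h : RegularTreeAction G φ t d) (n : ℕ) :
    h.levelStab n →* ∀ α : treeLevel φ t n, Equiv.Perm (TreeFiber φ (α : V)) where
  toFun x α :=
    { toFun := fun y => ⟨(x : G) • (y : V), by rw [h.map_smul, y.2, h.smul_eq x α.2]⟩
      invFun := fun y => ⟨(x⁻¹ : h.levelStab n) • (y : V), by
        rw [Subgroup.smul_def, h.map_smul, y.2, h.smul_eq x⁻¹ α.2]⟩
      left_inv := fun y => Subtype.ext (inv_smul_smul (x : G) (y : V))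
      right_inv := fun y => Subtype.ext (smul_inv_smul (x : G) (y : V)) }
  map_one' := by ext α y; simp
  map_mul' g g' := by ext α y; simp [mul_smul]

@[simp]
theorem coe_fiberPerm (h : RegularTreeAction G φ t d) (n : ℕ) (x : h.levelStab n)
    (α : treeLevel φ t n) (y : TreeFiber φ (α : V)) :
    (h.fiberPerm n x α y : V) = (x : G) • (y : V) := rfl

theorem mem_levelStab_succ (h : RegularTreeAction G φ t d) {n : ℕ} (x : h.levelStab n)
    (hx : h.fiberPerm n x = 1) : (x : G) ∈ h.levelStab (n + 1) := by
  rw [mem_fixingSubgroup_iff]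
  intro y hy
  have := congrArg Subtype.val
    (DFunLike.congr_fun (congrFun hx ⟨φ y, hy⟩) (⟨y, rfl⟩ : TreeFiber φ (φ y)))
  simpa using this

/-- The bijection between the children of `α` and of `g • α`. -/
def fiberEquiv (h : RegularTreeAction G φ t d) (g : G) (α : V) :
    TreeFiber φ α ≃ TreeFiber φ (g • α) where
  toFun y := ⟨g • (y : V), by rw [h.map_smul, y.2]⟩
  invFun y := ⟨g⁻¹ • (y : V), by rw [h.map_smul, y.2, inv_smul_smul]⟩
  left_inv y := Subtype.ext (inv_smul_smul g (y : V))
  right_inv y := Subtype.ext (smul_inv_smul g (y : V))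

/-- Surjectivity provides an element of the stabilizer whose only nontrivial component is a
transposition in one fiber. -/
theorem exists_swap [DecidableEq V] (h : RegularTreeAction G φ t d) {n : ℕ}
    (hs : Function.Surjective (h.fiberPerm n)) {a b : V} (ha : a ∈ treeLevel φ t (n + 1))
    (hab : φ b = φ a) :
    ∃ g : G, ∀ y ∈ treeLevel φ t (n + 1), g • y = Equiv.swap a b y := by
  obtain ⟨x, hx⟩ := hs (Pi.mulSingle ⟨φ a, ha⟩
    (Equiv.swap (⟨a, rfl⟩ : TreeFiber φ (φ a)) ⟨b, hab⟩))
  refine ⟨x, fun y hy => ?_⟩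
  have hy' := congrArg Subtype.val
    (DFunLike.congr_fun (congrFun hx ⟨φ y, hy⟩) (⟨y, rfl⟩ : TreeFiber φ (φ y)))
  rw [coe_fiberPerm] at hy'
  rw [show (x : G) • y = _ from hy']
  by_cases hya : φ y = φ a
  · have key : ∀ (β : treeLevel φ t n) (hβ : (⟨φ a, ha⟩ : treeLevel φ t n) = β)
        (z : TreeFiber φ (β : V)), (((Pi.mulSingle ⟨φ a, ha⟩
        (Equiv.swap (⟨a, rfl⟩ : TreeFiber φ (φ a)) ⟨b, hab⟩) :
        ∀ α : treeLevel φ t n, Equiv.Perm (TreeFiber φ (α : V))) β z : TreeFiber φ (β : V)) : V) =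
        Equiv.swap a b (z : V) := by
      rintro _ rfl z
      rw [Pi.mulSingle_eq_same, Equiv.swap_apply_def, Equiv.swap_apply_def]
      simp only [Subtype.ext_iff]
      split_ifs <;> rfl
    exact key ⟨φ y, hy⟩ (Subtype.ext hya.symm) ⟨y, rfl⟩
  · rw [Pi.mulSingle_eq_of_ne (by simpa [Subtype.ext_iff] using hya),
      Equiv.swap_apply_of_ne_of_ne (by rintro rfl; exact hya rfl) (by rintro rfl; exact hya hab)]
    rfl

theorem exists_smul_eq (h : RegularTreeAction G φ t d) (n : ℕ)
    (hs : ∀ i < n, Function.Surjective (h.fiberPerm i)) {x y : V} (hx : x ∈ treeLevel φ t n)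
    (hy : y ∈ treeLevel φ t n) : ∃ g : G, g • x = y := by
  classical
  induction n generalizing x y with
  | zero =>
    obtain rfl : x = t := hx
    obtain rfl : y = x := hy
    exact ⟨1, one_smul _ _⟩
  | succ n ih =>
    obtain ⟨g, hg⟩ := ih (fun i hi => hs i (by omega)) (mem_treeLevel_succ.1 hx)
      (mem_treeLevel_succ.1 hy)
    obtain ⟨k, hk⟩ := h.exists_swap (hs n (by omega)) (h.smul_mem_treeLevel g hx)
      (b := y) (by rw [h.map_smul, hg])
    exact ⟨k * g, by rw [mul_smul, hk _ (h.smul_mem_treeLevel g hx), Equiv.swap_apply_left]⟩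

variable [DecidableEq V] [∀ n, Fintype (treeLevel φ t n)]

/-- The sign of the permutation of level `n + 1`. -/
def levelSign (h : RegularTreeAction G φ t d) (n : ℕ) : G →* ℤˣ :=
  Equiv.Perm.sign.comp (h.levelPerm (n + 1))

variable [∀ n (α : treeLevel φ t n), Fintype (TreeFiber φ (α : V))]

theorem levelSign_eq_signProd (h : RegularTreeAction G φ t d) {n : ℕ} (x : h.levelStab n) :
    h.levelSign n x = signProd 1 (h.fiberPerm n x) := by
  have h1 := Equiv.Perm.sign_eq_sign_of_equiv
    (Equiv.Perm.sigmaCongrRight (h.fiberPerm n x)) (h.levelPerm (n + 1) x)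
    (treeLevelSuccEquiv n) (by rintro ⟨α, y⟩; rfl)
  rw [levelSign, MonoidHom.comp_apply, ← h1, Equiv.Perm.sign_sigmaCongrRight_eq_prod]
  simp [signProd]

/-- Conjugating by `g` carries the permutation of the fiber over `α` to the fiber over `g • α`, so
it only relabels the exponents. -/
theorem signProd_conj (h : RegularTreeAction G φ t d) {n : ℕ} (g : G) (x : h.levelStab n)
    (w : treeLevel φ t n → ZMod 2) :
    signProd w (h.fiberPerm n ⟨g * x * g⁻¹, h.conj_mem g x.2⟩) =
      signProd (fun α => w (h.levelPerm n g α)) (h.fiberPerm n x) := by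
  simp only [signProd, MonoidHom.coe_mk, OneHom.coe_mk]
  rw [← Equiv.prod_comp (h.levelPerm n g)]
  refine Finset.prod_congr rfl fun α _ => ?_
  congr 1
  symm
  refine Equiv.Perm.sign_eq_sign_of_equiv _ _ (h.fiberEquiv g α) fun y => Subtype.ext ?_
  change g • (x : G) • (y : V) = (g * x * g⁻¹) • g • (y : V)
  rw [smul_smul, smul_smul, inv_mul_cancel_right]

theorem signProd_injective (h : RegularTreeAction G φ t d) {n : ℕ}
    {v w : treeLevel φ t n → ZMod 2}
    (hvw : ∀ x : ∀ α : treeLevel φ t n, Equiv.Perm (TreeFiber φ (α : V)),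
      signProd v x = signProd w x) : v = w := by
  funext α
  have := h.nontrivial_fiber α.2
  obtain ⟨p, hp⟩ := Equiv.Perm.sign_surjective (TreeFiber φ (α : V)) (-1)
  have h1 := hvw (Pi.mulSingle α p)
  rw [signProd_mulSingle, signProd_mulSingle, hp] at h1
  generalize v α = a at h1
  generalize w α = b at h1
  revert a b
  decide

/-- Characters of `G` that are trivial on the stabilizer of level `n` are products of
level signs. -/
theorem exists_eq_prod_levelSign (h : RegularTreeAction G φ t d) (n : ℕ)
    (hs : ∀ i < n, Function.Surjective (h.fiberPerm i)) (χ : G →* ℤˣ)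
    (hχ : ∀ g ∈ h.levelStab n, χ g = 1) :
    ∃ E ⊆ Finset.range n, ∀ g, χ g = ∏ i ∈ E, h.levelSign i g := by
  induction n generalizing χ with
  | zero =>
    refine ⟨∅, by simp, fun g => ?_⟩
    rw [Finset.prod_empty]
    refine hχ g ((mem_fixingSubgroup_iff G).2 ?_)
    rintro _ rfl
    exact h.smul_root g
  | succ n ih =>
    have hsn := hs n (by omega)
    let χ' : (∀ α : treeLevel φ t n, Equiv.Perm (TreeFiber φ (α : V))) →* ℤˣ :=
      (h.fiberPerm n).liftOfSurjective hsn ⟨χ.comp (h.levelStab n).subtype, fun x hx =>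
        hχ x (h.mem_levelStab_succ x hx)⟩
    have hχ' (x : h.levelStab n) : χ' (h.fiberPerm n x) = χ x :=
      MonoidHom.liftOfRightInverse_comp_apply _ _ _ ⟨χ.comp (h.levelStab n).subtype, _⟩ x
    obtain ⟨w, hw⟩ := exists_eq_signProd χ'
    -- A character does not see conjugation, so `w` is `G`-invariant; transitivity on level `n` then
    -- makes it constant.
    have hinv (g : G) : (fun α => w (h.levelPerm n g α)) = w := by
      refine h.signProd_injective fun p => ?_
      obtain ⟨x, rfl⟩ := hsn p
      rw [← h.signProd_conj, ← hw, hχ', hχ']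
      rw [map_mul, map_mul, map_inv, mul_comm (χ g), mul_inv_cancel_right]
    obtain ⟨α₀, hα₀⟩ := h.exists_mem_treeLevel n
    have hconst : w = fun _ => w ⟨α₀, hα₀⟩ := by
      funext α
      obtain ⟨g, hg⟩ := h.exists_smul_eq n (fun i hi => hs i (by omega)) hα₀ α.2
      rw [← congrFun (hinv g) ⟨α₀, hα₀⟩]
      congr 1
      exact Subtype.ext hg.symm
    -- If the constant is 0, `χ` is already trivial on the stabilizer of level `n`. If it is 1, `χ`
    -- agrees there with the level sign, and multiplying by that sign reduces to the first case.
    by_cases he : w ⟨α₀, hα₀⟩ = 0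
    · obtain ⟨E, hE, hE'⟩ := ih (fun i hi => hs i (by omega)) χ fun g hg => by
        have := hχ' ⟨g, hg⟩
        rw [hw, hconst, he] at this
        rw [← this]
        simp [signProd]
      exact ⟨E, hE.trans (Finset.range_mono (by omega)), hE'⟩
    · obtain ⟨E, hE, hE'⟩ := ih (fun i hi => hs i (by omega)) (χ * h.levelSign n) fun g hg => by
        have h1 := hχ' ⟨g, hg⟩
        rw [hw, hconst, Fin.eq_one_of_ne_zero _ he] at h1
        have h2 := h.levelSign_eq_signProd ⟨g, hg⟩
        rw [MonoidHom.mul_apply, ← h1, h2]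
        exact Int.units_mul_self _
      refine ⟨insert n E, ?_, fun g => ?_⟩
      · rw [Finset.range_add_one]
        exact Finset.insert_subset_insert n hE
      · rw [Finset.prod_insert (fun hn => by simpa using hE hn), ← hE' g, MonoidHom.mul_apply,
          mul_left_comm, Int.units_mul_self, mul_one]

/-- Exponents on level `n - k` whose pullback to level `n` gives a product of signs that is
trivial on the stabilizer of level `n`. -/
def vanishing (h : RegularTreeAction G φ t d) (n k : ℕ) : AddSubgroup (V → ZMod 2) where
  carrier := {u | ∀ x, signProd (fun α : treeLevel φ t n => u (φ^[k] α)) (h.fiberPerm n x) = 1}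
  zero_mem' x := by simp [signProd]
  add_mem' {u v} hu hv x := by
    have := signProd_add (fun α : treeLevel φ t n => u (φ^[k] α)) (fun α => v (φ^[k] α))
      (h.fiberPerm n x)
    rw [hu, hv] at this
    exact this.trans (one_mul 1)
  neg_mem' {u} hu x := by
    rw [show -u = u from funext fun y => CharTwo.neg_eq (u y)]
    exact hu x

theorem vanishing_congr (h : RegularTreeAction G φ t d) {j k n : ℕ} (hn : j + k = n)
    {u v : V → ZMod 2} (huv : ∀ y ∈ treeLevel φ t j, u y = v y) (hu : u ∈ h.vanishing n k) :
    v ∈ h.vanishing n k := by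
  intro x
  rw [← hu x]
  congr 2
  funext α
  exact (huv _ (iterate_mem_treeLevel hn α.2)).symm

theorem vanishing_smul (h : RegularTreeAction G φ t d) {n k : ℕ} (g : G) {u : V → ZMod 2}
    (hu : u ∈ h.vanishing n k) : (fun y => u (g • y)) ∈ h.vanishing n k := by
  intro x
  rw [← hu ⟨g * x * g⁻¹, h.conj_mem g x.2⟩, h.signProd_conj]
  simp [h.iterate_smul]

/-- A nonzero relation is pushed down towards the root, where it becomes the all-ones relation. At
each level it either is constant on sibling sets and descends, or produces the indicator of a whole
sibling set, which descends too. -/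
theorem vanishing_one (h : RegularTreeAction G φ t d) {j k n : ℕ} (hn : j + k = n)
    (hs : ∀ i < n, Function.Surjective (h.fiberPerm i)) {u : V → ZMod 2}
    (hu : u ∈ h.vanishing n k) {b₀ : V} (hb₀ : b₀ ∈ treeLevel φ t j) (hub : u b₀ ≠ 0)
    (x : h.levelStab n) : signProd 1 (h.fiberPerm n x) = 1 := by
  induction j generalizing k u b₀ with
  | zero =>
    rw [zero_add] at hn
    subst hn
    rw [← hu x]
    congr 2
    funext α
    rw [show φ^[k] (α : V) = b₀ from (show φ^[k] (α : V) = t from α.2).trans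
      (show b₀ = t from hb₀).symm]
    exact (Fin.eq_one_of_ne_zero _ hub).symm
  | succ j ih =>
    by_cases hconst : ∀ b ∈ treeLevel φ t (j + 1), ∀ c, φ c = φ b → u c = u b
    · classical
      let v : V → ZMod 2 := fun β => if hβ : ∃ c, φ c = β then u hβ.choose else 0
      have hv (b : V) (hb : b ∈ treeLevel φ t (j + 1)) : v (φ b) = u b := by
        have hβ : ∃ c, φ c = φ b := ⟨b, rfl⟩
        simp only [v, dif_pos hβ]
        exact hconst b hb _ hβ.choose_spec
      refine ih (k := k + 1) (by omega) (u := v) (fun x => ?_) (b₀ := φ b₀) hb₀ (by rwa [hv b₀ hb₀])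
      rw [← hu x]
      congr 2
      funext α
      rw [Function.iterate_succ_apply', hv _ (iterate_mem_treeLevel hn α.2)]
    · push Not at hconst
      obtain ⟨b, hb, c, hcb, hne⟩ := hconst
      have hsj := hs j (by omega)
      have hbc : b ≠ c := by rintro rfl; exact hne rfl
      have hcl : c ∈ treeLevel φ t (j + 1) := mem_treeLevel_succ.2 (hcb ▸ hb)
      -- Adding to `u` its translate by the transposition of `b` and `c` cancels every value except
      -- at these two siblings, where `u` differs.
      have h1 : (Pi.single b 1 + Pi.single c 1 : V → ZMod 2) ∈ h.vanishing n k := by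
        obtain ⟨g, hg⟩ := h.exists_swap hsj hb hcb
        refine h.vanishing_congr hn (fun y hy => ?_) (add_mem hu (h.vanishing_smul g hu))
        rw [Pi.add_apply, Pi.add_apply, hg y hy]
        have h01 : ∀ p q : ZMod 2, p ≠ q → p + q = 1 := by decide
        by_cases hyb : y = b
        · subst hyb
          rw [Equiv.swap_apply_left, h01 _ _ hne.symm]
          simp [hbc]
        by_cases hyc : y = c
        · subst hyc
          rw [Equiv.swap_apply_right, h01 _ _ hne]
          simp [hyb]
        · rw [Equiv.swap_apply_of_ne_of_ne hyb hyc, CharTwo.add_self_eq_zero]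
          simp [hyb, hyc]
      have h2 (e : V) (he : φ e = φ b) :
          (Pi.single b 1 + Pi.single e 1 : V → ZMod 2) ∈ h.vanishing n k := by
        by_cases heb : e = b
        · subst heb
          convert (h.vanishing n k).zero_mem
          funext y
          exact CharTwo.add_self_eq_zero _
        by_cases hec : e = c
        · subst hec; exact h1
        obtain ⟨g, hg⟩ := h.exists_swap hsj hcl (b := e) (by rw [he, hcb])
        refine h.vanishing_congr hn (fun y hy => ?_) (h.vanishing_smul g h1)
        rw [hg y hy]
        by_cases hyb : y = b
        · subst hyb
          rw [Equiv.swap_apply_of_ne_of_ne hbc (Ne.symm heb)]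
          simp [hbc, Ne.symm heb]
        by_cases hyc : y = c
        · subst hyc
          rw [Equiv.swap_apply_left]
          simp [hyb, Ne.symm hec, heb, hec]
        by_cases hye : y = e
        · subst hye
          rw [Equiv.swap_apply_right]
          simp [hyb, hbc.symm]
        · rw [Equiv.swap_apply_of_ne_of_ne hyc hye]
          simp [hyb, hyc, hye]
      have : Fintype (TreeFiber φ (φ b)) :=
        inferInstanceAs (Fintype (TreeFiber φ ((⟨φ b, hb⟩ : treeLevel φ t j) : V)))
      -- In the sum over all siblings `e` of `e_b + e_e`, the `d` copies of `e_b` cancel because `d`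
      -- is even. What remains is the indicator of the fiber, pulled back from the single vertex `φ
      -- b`.
      have h3 := sum_mem (B := AddSubgroup (V → ZMod 2)) (S := h.vanishing n k)
        (t := Finset.univ) (f := fun e : TreeFiber φ (φ b) =>
          (Pi.single b 1 + Pi.single (e : V) 1 : V → ZMod 2)) fun e _ => h2 e e.2
      refine ih (k := k + 1) (by omega) (u := Pi.single (φ b) 1) (fun x => ?_) (b₀ := φ b) hb
        (by simp)
      rw [← h3 x]
      congr 2
      funext α
      rw [Function.iterate_succ_apply', Finset.sum_add_distrib, Pi.add_apply, Finset.sum_const,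
        Finset.card_univ, ← Nat.card_eq_fintype_card, h.card_fiber j _ hb, Pi.smul_apply,
        nsmul_eq_mul, (ZMod.natCast_eq_zero_iff_even).2 h.even, zero_mul, zero_add,
        Finset.sum_apply]
      by_cases hα : φ (φ^[k] (α : V)) = φ b
      · rw [hα, Pi.single_eq_same, Finset.sum_eq_single ⟨φ^[k] (α : V), hα⟩]
        · simp
        · intro e _ he
          rw [Pi.single_eq_of_ne]
          rintro h'
          exact he (Subtype.ext h'.symm)
        · simp
      · rw [Pi.single_eq_of_ne hα, Finset.sum_eq_zero]
        intro e _
        rw [Pi.single_eq_of_ne]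
        intro h'
        exact hα (h' ▸ e.2)

/-- `halt` supplies the even permutations of each fiber, though not from elements fixing the whole
level; `hsign` excludes relations between level signs. Normality of the image of the stabilizer in
each factor joins the two. -/
theorem fiberPerm_surjective (h : RegularTreeAction G φ t d)
    (halt : ∀ n, ∀ α : treeLevel φ t n, ∀ p : Equiv.Perm (TreeFiber φ (α : V)),
      Equiv.Perm.sign p = 1 → ∃ g : G, ∀ y : TreeFiber φ (α : V), g • (y : V) = p y)
    (hsign : ∀ n, ∀ E ⊆ Finset.range n, ∃ g, h.levelSign n g ≠ ∏ i ∈ E, h.levelSign i g)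
    (n : ℕ) : Function.Surjective (h.fiberPerm n) := by
  induction n using Nat.strong_induction_on with
  | _ n hs =>
  have hmain : ∀ w : treeLevel φ t n → ZMod 2,
      (∀ x, signProd w (h.fiberPerm n x) = 1) → w = 0 := by
    intro w hw
    by_contra hne
    obtain ⟨b, hb⟩ := Function.ne_iff.1 hne
    classical
    let u : V → ZMod 2 := fun y => if hy : y ∈ treeLevel φ t n then w ⟨y, hy⟩ else 0
    have hu : u ∈ h.vanishing n 0 := fun x => by
      rw [← hw x]
      congr 2
      funext α
      simp [u]
    have h1 := h.vanishing_one (j := n) (k := 0) rfl hs hu b.2 (by simpa [u] using hb)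
    obtain ⟨E, hE, hE'⟩ := h.exists_eq_prod_levelSign n hs (h.levelSign n) fun g hg => by
      rw [← h1 ⟨g, hg⟩]
      exact h.levelSign_eq_signProd ⟨g, hg⟩
    obtain ⟨g, hg⟩ := hsign n E hE
    exact hg (hE' g)
  rw [← MonoidHom.range_eq_top]
  refine eq_top_of_signProd_ne _ (fun α p => ?_) fun w hw => hmain w fun x => hw _ ⟨x, rfl⟩
  -- Otherwise the sign of the single coordinate `α` would be a vanishing product.
  obtain ⟨x₀, hx₀⟩ : ∃ x, Equiv.Perm.sign (h.fiberPerm n x α) ≠ 1 := by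
    by_contra! hcon
    have := congrFun (hmain (Pi.single α 1) fun x => by
      simp only [signProd, MonoidHom.coe_mk, OneHom.coe_mk]
      refine Finset.prod_eq_one fun β _ => ?_
      by_cases hβ : β = α
      · subst hβ; simp [hcon]
      · simp [hβ]) α
    simp at this
  have hall (q : Equiv.Perm (TreeFiber φ (α : V))) :
      ∃ g : G, ∀ y : TreeFiber φ (α : V), g • (y : V) = q y := by
    rcases Int.units_eq_one_or (Equiv.Perm.sign q) with hq | hq
    · exact halt n α q hq
    · obtain ⟨g, hg⟩ := halt n α (q * (h.fiberPerm n x₀ α)⁻¹) (by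
        rw [map_mul, map_inv, hq, (Int.units_eq_one_or _).resolve_left hx₀]; rfl)
      refine ⟨g * x₀, fun y => ?_⟩
      rw [mul_smul, ← h.coe_fiberPerm n x₀ α y, hg]
      simp
  let N : Subgroup (Equiv.Perm (TreeFiber φ (α : V))) :=
    ((Pi.evalMonoidHom (fun α : treeLevel φ t n => Equiv.Perm (TreeFiber φ (α : V))) α).comp
      (h.fiberPerm n)).range
  -- By `hall` every permutation of the fiber is induced by some `g` in `G`, and conjugation by `g`
  -- preserves the stabilizer of the level.
  have hN : N.Normal := by
    refine ⟨?_⟩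
    rintro _ ⟨x, rfl⟩ q
    obtain ⟨g, hg⟩ := hall q
    refine ⟨⟨g * x * g⁻¹, h.conj_mem g x.2⟩, ?_⟩
    ext y
    have hy : g⁻¹ • (y : V) = (q⁻¹ y : TreeFiber φ (α : V)) := by
      rw [inv_smul_eq_iff, hg]
      simp
    simp only [MonoidHom.comp_apply, Pi.evalMonoidHom_apply, coe_fiberPerm, mul_smul, hy,
      Equiv.Perm.mul_apply]
    rw [← hg]
    rfl
  have htop := Equiv.Perm.eq_top_of_odd_mem_normal N hN _ ⟨x₀, rfl⟩ hx₀
  obtain ⟨x, hx⟩ : p ∈ N := htop ▸ Subgroup.mem_top p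
  exact ⟨_, ⟨x, rfl⟩, hx⟩

end RegularTreeAction

/-! ### Automorphisms of the preimage graph and their realization by Galois elements. -/

theorem aeval_iteratePoly {F : Type*} [Field F] {L : Type*} [Field L] [Algebra F L]
    (f : F[X]) (n : ℕ) (x : L) : aeval x (iteratePoly f n) = (polyMap L f)^[n] x := by
  induction n with
  | zero => simp [iteratePoly]
  | succ n ih =>
    rw [iteratePoly, Function.iterate_succ_apply', aeval_comp, ← iteratePoly, ih,
      Function.iterate_succ_apply']
    rfl

theorem mem_preimageSet_iff {F : Type*} [Field F] {L : Type*} [Field L] [Algebra F L]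
    {f : F[X]} {t : F} {x : L} :
    x ∈ preimageSet L f t ↔ ∃ n, x ∈ treeLevel (polyMap L f) (algebraMap F L t) n := by
  refine exists_congr fun n => ?_
  rw [map_sub, aeval_C, sub_eq_zero, aeval_iteratePoly]
  rfl

theorem treeLevel_unique {V : Type*} {φ : V → V} {t : V} (hper : ∀ n, 1 ≤ n → φ^[n] t ≠ t)
    {m n : ℕ} {x : V} (hm : x ∈ treeLevel φ t m) (hn : x ∈ treeLevel φ t n) : m = n := by
  wlog hmn : m ≤ n generalizing m n
  · exact (this hn hm (by omega)).symm
  by_contra hne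
  refine hper (n - m) (by omega) ?_
  have : φ^[n - m + m] x = t := by rwa [Nat.sub_add_cancel hmn]
  rwa [Function.iterate_add_apply, show φ^[m] x = t from hm] at this

namespace RegularTreeAction

variable {G V : Type*} [Group G] [MulAction G V] {φ : V → V} {t : V} {d : ℕ}

theorem exists_eqOn_treeLevel (h : RegularTreeAction G φ t d)
    (hs : ∀ n, Function.Surjective (h.fiberPerm n)) {τ : V → V} (hinj : Function.Injective τ)
    (hroot : τ t = t) (hτ : ∀ n, ∀ y ∈ treeLevel φ t (n + 1), φ (τ y) = τ (φ y)) (n : ℕ) :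
    ∃ g : G, ∀ x ∈ treeLevel φ t n, g • x = τ x := by
  induction n with
  | zero =>
    refine ⟨1, ?_⟩
    rintro _ rfl
    rw [one_smul]
    exact hroot.symm
  | succ n ih =>
    obtain ⟨g, hg⟩ := ih
    -- On each fiber `p` is the discrepancy between `g` and `τ`, corrected by an element of the
    -- stabilizer of level `n`.
    let p (α : treeLevel φ t n) : TreeFiber φ (α : V) → TreeFiber φ (α : V) := fun y =>
      ⟨g⁻¹ • τ y, by rw [h.map_smul, hτ n _ (fiber_mem α.2 y), y.2, ← hg _ α.2, inv_smul_smul]⟩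
    have hp (α) : Function.Bijective (p α) := by
      have := Nat.finite_of_card_ne_zero (α := TreeFiber φ (α : V)) (by
        rw [h.card_fiber n α α.2]; exact h.pos.ne')
      refine Finite.injective_iff_bijective.1 fun y z hyz => ?_
      have := congrArg Subtype.val hyz
      exact Subtype.ext (hinj (MulAction.injective g⁻¹ this))
    obtain ⟨x, hx⟩ := hs n fun α => Equiv.ofBijective (p α) (hp α)
    refine ⟨g * x, fun y hy => ?_⟩
    have := congrArg Subtype.val
      (DFunLike.congr_fun (congrFun hx ⟨φ y, hy⟩) (⟨y, rfl⟩ : TreeFiber φ (φ y)))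
    rw [coe_fiberPerm] at this
    rw [mul_smul, this]
    exact smul_inv_smul g (τ y)

end RegularTreeAction

section Arboreal

variable {F : Type*} [Field F] {L : Type*} [Field L] [Algebra F L] {f : F[X]} {t : F} {d : ℕ}

theorem preimageTree_adj_iff (hper : ∀ n, 1 ≤ n →
    (polyMap L f)^[n] (algebraMap F L t) ≠ algebraMap F L t) (α β : preimageSet L f t) :
    (preimageTree L f t).Adj α β ↔ polyMap L f α = β ∨ polyMap L f β = α := by
  rw [preimageTree, SimpleGraph.fromRel_adj, and_iff_right_of_imp]
  rintro h rfl
  have h' : polyMap L f α = α := by tauto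
  obtain ⟨n, hn⟩ := mem_preimageSet_iff.1 α.2
  have h1 : (α : L) ∈ treeLevel (polyMap L f) (algebraMap F L t) (n + 1) := by
    rw [RegularTreeAction.mem_treeLevel_succ, h']
    exact hn
  have := treeLevel_unique hper hn h1
  omega

theorem ncard_neighborSet_root (hper : ∀ n, 1 ≤ n →
    (polyMap L f)^[n] (algebraMap F L t) ≠ algebraMap F L t)
    (h : RegularTreeAction (L ≃ₐ[F] L) (polyMap L f) (algebraMap F L t) d)
    {α : preimageSet L f t} (hα : (α : L) = algebraMap F L t) :
    ((preimageTree L f t).neighborSet α).ncard = d := by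
  rw [← Set.ncard_image_of_injective _ Subtype.val_injective, ← h.card_fiber 0 _ hα]
  refine congrArg Set.ncard (Set.ext fun y => ?_)
  simp only [Set.mem_image, SimpleGraph.mem_neighborSet, preimageTree_adj_iff hper]
  constructor
  · rintro ⟨z, h1 | h1, rfl⟩
    · exfalso
      obtain ⟨n, hn⟩ := mem_preimageSet_iff.1 z.2
      have h2 : (α : L) ∈ treeLevel (polyMap L f) (algebraMap F L t) (n + 1) := by
        rw [RegularTreeAction.mem_treeLevel_succ, h1]
        exact hn
      have := treeLevel_unique hper h2 (n := 0) hα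
      omega
    · exact h1
  · intro hy
    exact ⟨⟨y, mem_preimageSet_iff.2 ⟨1, RegularTreeAction.mem_treeLevel_succ.2
      (by rw [show polyMap L f y = α from hy]; exact hα)⟩⟩, Or.inr hy, rfl⟩

theorem ncard_neighborSet_of_mem_treeLevel_succ (hper : ∀ n, 1 ≤ n →
    (polyMap L f)^[n] (algebraMap F L t) ≠ algebraMap F L t)
    (h : RegularTreeAction (L ≃ₐ[F] L) (polyMap L f) (algebraMap F L t) d)
    {α : preimageSet L f t} {n : ℕ}
    (hα : (α : L) ∈ treeLevel (polyMap L f) (algebraMap F L t) (n + 1)) :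
    ((preimageTree L f t).neighborSet α).ncard = d + 1 := by
  have hfin : {y : L | polyMap L f y = α}.Finite := Nat.finite_of_card_ne_zero (by
    rw [show Nat.card {y : L | polyMap L f y = α} = d from h.card_fiber _ _ hα]; exact h.pos.ne')
  have hcard : {y : L | polyMap L f y = α}.ncard = d := h.card_fiber _ _ hα
  have hnot : polyMap L f α ∉ {y : L | polyMap L f y = α} := by
    intro hmem
    have h2 : (α : L) ∈ treeLevel (polyMap L f) (algebraMap F L t) (n + 1 + 1 + 1) := by
      rw [RegularTreeAction.mem_treeLevel_succ, RegularTreeAction.mem_treeLevel_succ,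
        show polyMap L f (polyMap L f α) = α from hmem]
      exact hα
    have := treeLevel_unique hper hα h2
    omega
  rw [← Set.ncard_image_of_injective _ Subtype.val_injective, ← hcard,
    ← Set.ncard_insert_of_notMem hnot hfin]
  refine congrArg Set.ncard (Set.ext fun y => ?_)
  simp only [Set.mem_image, SimpleGraph.mem_neighborSet, preimageTree_adj_iff hper]
  constructor
  · rintro ⟨z, h1 | h1, rfl⟩
    · exact Or.inl h1.symm
    · exact Or.inr h1
  · rintro (rfl | hy)
    · exact ⟨⟨_, mem_preimageSet_iff.2 ⟨n, hα⟩⟩, Or.inl rfl, rfl⟩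
    · exact ⟨⟨y, mem_preimageSet_iff.2 ⟨n + 1 + 1, RegularTreeAction.mem_treeLevel_succ.2
        (by rw [show polyMap L f y = α from hy]; exact hα)⟩⟩, Or.inr hy, rfl⟩

/-- The root has `d` neighbors and every other vertex has `d + 1`, so graph automorphisms recognize
it. -/
theorem preimageTree_iso_apply_root (hper : ∀ n, 1 ≤ n →
    (polyMap L f)^[n] (algebraMap F L t) ≠ algebraMap F L t)
    (h : RegularTreeAction (L ≃ₐ[F] L) (polyMap L f) (algebraMap F L t) d)
    (τ : preimageTree L f t ≃g preimageTree L f t) {α : preimageSet L f t}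
    (hα : (α : L) = algebraMap F L t) : τ α = α := by
  have hcard : ((preimageTree L f t).neighborSet (τ α)).ncard = d := by
    rw [← ncard_neighborSet_root hper h hα]
    exact (Nat.card_congr (SimpleGraph.Iso.mapNeighborSet τ α)).symm
  obtain ⟨n, hn⟩ := mem_preimageSet_iff.1 (τ α).2
  cases n with
  | zero => exact Subtype.ext ((show ((τ α : preimageSet L f t) : L) = _ from hn).trans hα.symm)
  | succ n =>
    rw [ncard_neighborSet_of_mem_treeLevel_succ hper h hn] at hcard
    omega

/-- An edge must map to an edge; only its orientation is in doubt. If `τ α` were the parent of `τ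
β`, injectivity and the case of `β` would identify `α` with its own grandparent. -/
theorem preimageTree_iso_apply (hper : ∀ n, 1 ≤ n →
    (polyMap L f)^[n] (algebraMap F L t) ≠ algebraMap F L t)
    (h : RegularTreeAction (L ≃ₐ[F] L) (polyMap L f) (algebraMap F L t) d)
    (τ : preimageTree L f t ≃g preimageTree L f t) (n : ℕ) {α β : preimageSet L f t}
    (hα : (α : L) ∈ treeLevel (polyMap L f) (algebraMap F L t) (n + 1))
    (hβ : (β : L) = polyMap L f α) : polyMap L f (τ α) = τ β := by
  induction n generalizing α β with
  | zero =>
    have hβt : (β : L) = algebraMap F L t := hβ.trans hα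
    have hadj := τ.map_adj_iff.2 ((preimageTree_adj_iff hper α β).2 (Or.inl hβ.symm))
    rw [preimageTree_iso_apply_root hper h τ hβt, preimageTree_adj_iff hper] at hadj
    rw [preimageTree_iso_apply_root hper h τ hβt]
    rcases hadj with hadj | hadj
    · exact hadj
    · exfalso
      obtain ⟨n, hn⟩ := mem_preimageSet_iff.1 (τ α).2
      have h2 : (β : L) ∈ treeLevel (polyMap L f) (algebraMap F L t) (n + 1) := by
        rw [RegularTreeAction.mem_treeLevel_succ, hadj]
        exact hn
      have := treeLevel_unique hper h2 (n := 0) hβt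
      omega
  | succ n ih =>
    have hadj := τ.map_adj_iff.2 ((preimageTree_adj_iff hper α β).2 (Or.inl hβ.symm))
    rw [preimageTree_adj_iff hper] at hadj
    rcases hadj with hadj | hadj
    · exact hadj
    · exfalso
      have hβ1 : (β : L) ∈ treeLevel (polyMap L f) (algebraMap F L t) (n + 1) := by
        rw [hβ]
        exact hα
      let γ : preimageSet L f t := ⟨polyMap L f β, mem_preimageSet_iff.2 ⟨n, hβ1⟩⟩
      have h1 := ih (α := β) (β := γ) hβ1 rfl
      rw [hadj] at h1
      have h2 : α = γ := τ.injective (Subtype.ext h1)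
      rw [h2] at hα
      have h3 : (γ : L) ∈ treeLevel (polyMap L f) (algebraMap F L t) n := hβ1
      have := treeLevel_unique hper h3 hα
      omega

theorem isClosed_setOf_algEquiv_apply_eq [Algebra.IsAlgebraic F L] (x y : L) :
    IsClosed {σ : L ≃ₐ[F] L | σ x = y} := by
  rw [← isOpen_compl_iff, isOpen_iff_mem_nhds]
  intro σ hσ
  have hfin : FiniteDimensional F (IntermediateField.adjoin F {x}) :=
    IntermediateField.adjoin.finiteDimensional (Algebra.IsIntegral.isIntegral x)
  have hopen := IntermediateField.fixingSubgroup_isOpen (IntermediateField.adjoin F {x})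
  refine Filter.mem_of_superset
    ((hopen.leftCoset σ).mem_nhds ⟨1, Subgroup.one_mem _, mul_one σ⟩) ?_
  rintro _ ⟨ρ, hρ, rfl⟩ hmem
  refine hσ ?_
  have h1 : ρ x = x :=
    (IntermediateField.mem_fixingSubgroup_iff _ _).1 hρ x (IntermediateField.mem_adjoin_simple_self F x)
  have h2 : σ (ρ x) = y := hmem
  rwa [h1] at h2

/-- The Galois elements agreeing with `τ` on level `n` form a nonempty closed set, decreasing in
`n`; compactness gives a common element. -/
theorem arborealRep_range_eq_top [IsGalois F L] (hper : ∀ n, 1 ≤ n →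
    (polyMap L f)^[n] (algebraMap F L t) ≠ algebraMap F L t)
    (h : RegularTreeAction (L ≃ₐ[F] L) (polyMap L f) (algebraMap F L t) d)
    (hs : ∀ n, Function.Surjective (h.fiberPerm n)) : (arborealRep L f t).range = ⊤ := by
  classical
  rw [MonoidHom.range_eq_top]
  intro τ
  let τ' : L → L := fun x => if hx : x ∈ preimageSet L f t then τ ⟨x, hx⟩ else x
  have hτ' (x : preimageSet L f t) : τ' x = τ x := by simp [τ']
  have hinj : Function.Injective τ' := by
    intro x y hxy
    by_cases hx : x ∈ preimageSet L f t <;> by_cases hy : y ∈ preimageSet L f t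
    · rw [hτ' ⟨x, hx⟩, hτ' ⟨y, hy⟩] at hxy
      exact congrArg Subtype.val (τ.injective (Subtype.ext hxy))
    · rw [hτ' ⟨x, hx⟩] at hxy
      simp only [τ', dif_neg hy] at hxy
      exact absurd (hxy ▸ (τ ⟨x, hx⟩).2) hy
    · rw [hτ' ⟨y, hy⟩] at hxy
      simp only [τ', dif_neg hx] at hxy
      exact absurd (hxy ▸ (τ ⟨y, hy⟩).2) hx
    · simpa [τ', hx, hy] using hxy
  have htmem : algebraMap F L t ∈ preimageSet L f t := mem_preimageSet_iff.2 ⟨0, rfl⟩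
  have hroot : τ' (algebraMap F L t) = algebraMap F L t := by
    rw [hτ' ⟨_, htmem⟩, preimageTree_iso_apply_root hper h τ rfl]
  have hcomm (n : ℕ) (y : L) (hy : y ∈ treeLevel (polyMap L f) (algebraMap F L t) (n + 1)) :
      polyMap L f (τ' y) = τ' (polyMap L f y) := by
    rw [hτ' ⟨y, mem_preimageSet_iff.2 ⟨_, hy⟩⟩,
      hτ' ⟨polyMap L f y, mem_preimageSet_iff.2 ⟨n, hy⟩⟩]
    exact preimageTree_iso_apply hper h τ n hy rfl
  have hex := h.exists_eqOn_treeLevel hs hinj hroot hcomm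
  let S (n : ℕ) : Set (L ≃ₐ[F] L) :=
    ⋂ x ∈ treeLevel (polyMap L f) (algebraMap F L t) n, {σ | σ x = τ' x}
  have hclosed (n) : IsClosed (S n) :=
    isClosed_biInter fun x _ => isClosed_setOf_algEquiv_apply_eq x (τ' x)
  obtain ⟨σ, hσ⟩ := IsCompact.nonempty_iInter_of_sequence_nonempty_isCompact_isClosed S
    (fun n σ hσ => by
      simp only [S, Set.mem_iInter] at hσ ⊢
      intro x hx
      obtain ⟨y⟩ := (h.nontrivial_fiber hx).to_nonempty
      have hy := RegularTreeAction.fiber_mem hx y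
      have h1 : σ y = τ' y := hσ y hy
      have h2 := hcomm n y hy
      rw [← h1, polyMap_algEquiv, y.2] at h2
      exact h2)
    (fun n => by
      obtain ⟨g, hg⟩ := hex n
      exact ⟨g, by simpa [S] using hg⟩)
    (hclosed 0).isCompact hclosed
  refine ⟨σ, RelIso.ext fun x => Subtype.ext ?_⟩
  obtain ⟨n, hn⟩ := mem_preimageSet_iff.1 x.2
  have h1 : σ x = τ' x := by
    have := Set.mem_iInter.1 hσ n
    simp only [S, Set.mem_iInter] at this
    exact this x hn
  rw [hτ'] at h1
  exact h1

end Arboreal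

/-! ### Iterates over transcendental points: separability, degrees and fibers. -/

theorem polyMap_overRatFunc {K : Type*} [Field K] {L : Type*} [Field L] [Algebra K L]
    [Algebra (RatFunc K) L] [IsScalarTower K (RatFunc K) L] (f : K[X]) :
    polyMap L (overRatFunc f) = polyMap L f :=
  funext fun x => aeval_map_algebraMap (RatFunc K) x f

theorem iteratePoly_succ_comp {K : Type*} [Field K] (f : K[X]) (n : ℕ) :
    iteratePoly f (n + 1) = (iteratePoly f n).comp f := by
  induction n with
  | zero => simp [iteratePoly]
  | succ n ih =>
    have h (m) : iteratePoly f (m + 1) = f.comp (iteratePoly f m) :=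
      Function.iterate_succ_apply' _ _ _
    rw [h (n + 1), ih, ← comp_assoc, ← h, ih]

theorem iteratePoly_overRatFunc {K : Type*} [Field K] (f : K[X]) (n : ℕ) :
    iteratePoly (overRatFunc f) n = overRatFunc (iteratePoly f n) := by
  induction n with
  | zero => simp [iteratePoly, overRatFunc]
  | succ n ih =>
    rw [iteratePoly_succ_comp, iteratePoly_succ_comp, ih, overRatFunc, overRatFunc, overRatFunc,
      Polynomial.map_comp]

theorem natDegree_iteratePoly {K : Type*} [Field K] (f : K[X]) (n : ℕ) :
    (iteratePoly f n).natDegree = f.natDegree ^ n := by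
  rw [iteratePoly, natDegree_iterate_comp, natDegree_X, mul_one]

theorem derivative_iteratePoly_succ {K : Type*} [Field K] (f : K[X]) (n : ℕ) :
    derivative (iteratePoly f (n + 1)) =
      derivative f * (derivative (iteratePoly f n)).comp f := by
  rw [iteratePoly_succ_comp, derivative_comp]

theorem natDegree_pos_of_derivative_ne_zero {K : Type*} [Field K] {f : K[X]}
    (hf : derivative f ≠ 0) : 0 < f.natDegree := by
  by_contra h
  rw [eq_C_of_natDegree_eq_zero (by omega : f.natDegree = 0), derivative_C] at hf
  exact hf rfl

theorem derivative_iteratePoly_ne_zero {K : Type*} [Field K] {f : K[X]} (hf : derivative f ≠ 0)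
    (n : ℕ) : derivative (iteratePoly f n) ≠ 0 := by
  induction n with
  | zero => simp [iteratePoly]
  | succ n ih =>
    rw [derivative_iteratePoly_succ]
    refine mul_ne_zero hf fun h => ?_
    rcases comp_eq_zero_iff.1 h with h | ⟨_, h⟩
    · exact ih h
    · have := natDegree_pos_of_derivative_ne_zero hf
      rw [h, natDegree_C] at this
      omega

theorem IsAlgebraic.aeval {K L : Type*} [Field K] [Field L] [Algebra K L] {x : L}
    (hx : IsAlgebraic K x) (p : K[X]) : IsAlgebraic K (Polynomial.aeval x p) :=
  (IsIntegral.of_mem_of_fg _ hx.isIntegral.fg_adjoin_singleton _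
    (aeval_mem_adjoin_singleton K x)).isAlgebraic

/-- A multiple root is a root of `f'`, hence algebraic over `K`, and so would be its image `α`. -/
theorem separable_map_sub_C {K L : Type*} [Field K] [Field L] [Algebra K L] {f : K[X]}
    (hf : derivative f ≠ 0) {α : L} (hα : Transcendental K α) :
    (f.map (algebraMap K L) - C α).Separable := by
  rw [Polynomial.Separable, isCoprime_iff_aeval_ne_zero_of_isAlgClosed L (AlgebraicClosure L)]
  intro y
  by_contra! h
  obtain ⟨h1, h2⟩ := h
  simp only [map_sub, derivative_C, sub_zero, derivative_map, aeval_map_algebraMap, aeval_C,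
    sub_eq_zero] at h1 h2
  have hy : IsAlgebraic K y := ⟨_, hf, h2⟩
  refine hα ((isAlgebraic_algebraMap_iff (algebraMap L (AlgebraicClosure L)).injective).1 ?_)
  rw [← h1]
  exact hy.aeval f

section Level

variable {K : Type*} [Field K] {L : Type*} [Field L] [Algebra K L] {f : K[X]} {t : L}

theorem transcendental_of_mem_treeLevel (ht : Transcendental K t) {n : ℕ} {α : L}
    (hα : α ∈ treeLevel (polyMap L f) t n) : Transcendental K α := by
  intro h
  refine ht ?_
  rw [← show (polyMap L f)^[n] α = t from hα, ← aeval_iteratePoly]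
  exact h.aeval _

theorem natDegree_map_sub_C (p : K[X]) (α : L) :
    (p.map (algebraMap K L) - C α).natDegree = p.natDegree := by
  rw [natDegree_sub_C, natDegree_map]

theorem map_sub_C_eq_prod [IsSepClosed L] {p : K[X]} (hp : derivative p ≠ 0)
    {α : L} (hα : Transcendental K α) [Fintype {y : L // aeval y p = α}] :
    p.map (algebraMap K L) - C α =
      C (algebraMap K L p.leadingCoeff) * ∏ y : {y : L // aeval y p = α}, (X - C (y : L)) := by
  classical
  have hsep := separable_map_sub_C hp hα
  have hsplit := IsSepClosed.splits_of_separable _ hsep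
  have hdeg := natDegree_pos_of_derivative_ne_zero hp
  have hlead : (p.map (algebraMap K L) - C α).leadingCoeff = algebraMap K L p.leadingCoeff := by
    rw [leadingCoeff, natDegree_map_sub_C, coeff_sub, coeff_map, coeff_C_of_ne_zero hdeg.ne', sub_zero]
    rfl
  have hne : p.map (algebraMap K L) - C α ≠ 0 := hsep.ne_zero
  conv_lhs => rw [hsplit.eq_prod_roots, hlead]
  congr 1
  rw [← Finset.prod_subtype (p := fun y : L => aeval y p = α) (F := inferInstance)
    (p.map (algebraMap K L) - C α).roots.toFinset
    (fun y => by
      rw [Multiset.mem_toFinset, mem_roots hne, IsRoot.def, eval_sub, eval_C, sub_eq_zero,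
        eval_map_algebraMap]) (fun y => X - C y),
    Finset.prod_eq_multiset_prod, Multiset.toFinset_val, (nodup_roots hsep).dedup]

theorem natCard_fiber [IsSepClosed L] {p : K[X]} (hp : derivative p ≠ 0) {α : L}
    (hα : Transcendental K α) : Nat.card {y : L // aeval y p = α} = p.natDegree := by
  have hsep := separable_map_sub_C hp hα
  have hsplit := IsSepClosed.splits_of_separable _ hsep
  rw [← natDegree_map_sub_C p α, ← card_rootSet_eq_natDegree (K := L) hsep
    (by rwa [Algebra.algebraMap_self, Polynomial.map_id]), ← Nat.card_eq_fintype_card]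
  refine Nat.card_congr (Equiv.subtypeEquivRight fun y => ?_)
  rw [mem_rootSet_of_ne hsep.ne_zero, map_sub, aeval_C, aeval_map_algebraMap, sub_eq_zero]
  rfl

theorem treeLevel_eq_setOf (n : ℕ) :
    treeLevel (polyMap L f) t n = {y : L | aeval y (iteratePoly f n) = t} := by
  ext y
  rw [Set.mem_ofPred_eq, aeval_iteratePoly]
  rfl

theorem finite_treeLevel [IsSepClosed L] (hf : derivative f ≠ 0) (ht : Transcendental K t)
    (n : ℕ) : Finite (treeLevel (polyMap L f) t n) := by
  rw [treeLevel_eq_setOf]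
  refine Nat.finite_of_card_ne_zero ?_
  rw [show Nat.card {y : L | aeval y (iteratePoly f n) = t} = _ from
    natCard_fiber (derivative_iteratePoly_ne_zero hf n) ht, natDegree_iteratePoly]
  exact (pow_pos (natDegree_pos_of_derivative_ne_zero hf) n).ne'

theorem finite_treeFiber [IsSepClosed L] (hf : derivative f ≠ 0) {α : L}
    (hα : Transcendental K α) : Finite (TreeFiber (polyMap L f) α) := by
  refine Nat.finite_of_card_ne_zero ?_
  rw [show Nat.card (TreeFiber (polyMap L f) α) = _ from natCard_fiber hf hα]
  exact (natDegree_pos_of_derivative_ne_zero hf).ne'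

theorem iterate_polyMap_ne (hdeg : 1 < f.natDegree) (ht : Transcendental K t) (n : ℕ)
    (hn : 1 ≤ n) : (polyMap L f)^[n] t ≠ t := by
  intro h
  rw [← aeval_iteratePoly] at h
  have h1 : iteratePoly f n = X := by
    by_contra hne
    exact ht ⟨iteratePoly f n - X, sub_ne_zero.2 hne, by simp [h]⟩
  have h2 := natDegree_iteratePoly f n
  rw [h1, natDegree_X] at h2
  have := Nat.one_lt_pow (by omega : n ≠ 0) hdeg
  omega

end Level

section Generic

variable {K : Type*} [Field K] {L : Type*} [Field L] [Algebra K L] [Algebra (RatFunc K) L]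
  [IsScalarTower K (RatFunc K) L]

theorem transcendental_algebraMap_X :
    Transcendental K (algebraMap (RatFunc K) L RatFunc.X) :=
  (transcendental_algebraMap_iff (algebraMap (RatFunc K) L).injective).2 RatFunc.transcendental_X

theorem regularTreeAction_polyMap [IsSepClosed L] {f : K[X]} (hf : derivative f ≠ 0)
    (heven : Even f.natDegree) :
    RegularTreeAction (L ≃ₐ[RatFunc K] L) (polyMap L f) (algebraMap (RatFunc K) L RatFunc.X)
      f.natDegree where
  map_smul g x := by
    rw [← polyMap_overRatFunc]
    exact polyMap_algEquiv _ g x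
  smul_root g := g.commutes _
  even := heven
  pos := natDegree_pos_of_derivative_ne_zero hf
  card_fiber n α hα :=
    natCard_fiber hf (transcendental_of_mem_treeLevel transcendental_algebraMap_X hα)

end Generic

/-! ### Even permutations of the fiber over each vertex. -/

/-- The abstract isomorphism type is used only through the order: the Galois group has index at most
2 in the permutations of the roots, so it contains the alternating group. -/
theorem exists_algEquiv_of_sign_eq_one {F L : Type*} [Field F] [Field L] [Algebra F L]
    [Normal F L] (p : F[X]) (hsplit : (p.map (algebraMap F L)).Splits) {d : ℕ} (hd : 1 < d)
    (hGal : Nonempty (p.Gal ≃* alternatingGroup (Fin d)) ∨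
      Nonempty (p.Gal ≃* Equiv.Perm (Fin d)))
    {X : Type*} [Fintype X] [DecidableEq X] (hX : Nat.card X = d) (e : X ≃ p.rootSet L)
    (π : Equiv.Perm X) (hπ : Equiv.Perm.sign π = 1) :
    ∃ σ : L ≃ₐ[F] L, ∀ x, σ (e x : L) = e (π x) := by
  classical
  have := Fact.mk hsplit
  have : Nontrivial (Fin d) := Fin.nontrivial_iff_two_le.2 hd
  have hcard : d.factorial ≤ 2 * Nat.card p.Gal := by
    rcases hGal with ⟨⟨E⟩⟩ | ⟨⟨E⟩⟩
    · rw [Nat.card_congr E.toEquiv, two_mul_nat_card_alternatingGroup, Nat.card_perm,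
        Nat.card_fin]
    · rw [Nat.card_congr E.toEquiv, Nat.card_perm, Nat.card_fin]
      omega
  let R := (Gal.galActionHom p L).range
  have hR : Nat.card R = Nat.card p.Gal :=
    (Nat.card_congr (MonoidHom.ofInjective (Gal.galActionHom_injective p L)).toEquiv).symm
  have hidx : R.index ≤ 2 := by
    have h1 := R.card_mul_index
    rw [Nat.card_perm, ← Nat.card_congr e, hX, hR] at h1
    by_contra! h2
    have h3 : 0 < Nat.card p.Gal := by
      have := d.factorial_pos
      omega
    nlinarith
  have hmem : e.permCongr π ∈ R :=
    Equiv.Perm.alternatingGroup_le_of_index_le_two hidx (Equiv.Perm.mem_alternatingGroup.2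
      (by rw [Equiv.Perm.sign_permCongr, hπ]))
  obtain ⟨g, hg⟩ := hmem
  obtain ⟨σ, rfl⟩ := Gal.restrict_surjective p L g
  refine ⟨σ, fun x => ?_⟩
  rw [← Gal.galActionHom_restrict p L σ (e x), hg]
  simp

/-- The embedding `K(t) → L` sending `t` to a transcendental element `α`. -/
def evalTranscendental {K L : Type*} [Field K] [Field L] [Algebra K L] {α : L}
    (hα : Transcendental K α) : RatFunc K →ₐ[K] L :=
  IsFractionRing.liftAlgHom (A := K[X]) (g := aeval α) (transcendental_iff_injective.1 hα)

theorem evalTranscendental_X {K L : Type*} [Field K] [Field L] [Algebra K L] {α : L}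
    (hα : Transcendental K α) : evalTranscendental hα RatFunc.X = α := by
  rw [evalTranscendental, IsFractionRing.liftAlgHom_apply, ← RatFunc.algebraMap_X,
    IsFractionRing.lift_algebraMap]
  exact aeval_X α

theorem RatFunc.algHom_ext_of_X {K L : Type*} [Field K] [Field L] [Algebra K L]
    {φ ψ : RatFunc K →ₐ[K] L} (h : φ RatFunc.X = ψ RatFunc.X) : φ = ψ := by
  have h1 : (φ : RatFunc K →+* L) = ψ := by
    refine IsLocalization.ringHom_ext (nonZeroDivisors K[X]) (Polynomial.ringHom_ext (fun a => ?_) ?_)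
    · simp [← RatFunc.algebraMap_eq_C]
    · simpa [RatFunc.algebraMap_X] using h
  exact AlgHom.ext fun x => DFunLike.congr_fun h1 x

theorem Normal.of_ringHom_comp {F E L : Type*} [Field F] [Field E] [Field L] [Algebra F L]
    [Normal F L] (i : F →+* E) (j : E →+* L) (hij : j.comp i = algebraMap F L) :
    @Normal E L _ _ j.toAlgebra := by
  let := i.toAlgebra
  let := j.toAlgebra
  have : IsScalarTower F E L := IsScalarTower.of_algebraMap_eq' hij.symm
  exact Normal.tower_top_of_normal F E L

theorem exists_ringEquiv_of_sign_eq_one {K : Type*} [Field K] {f : K[X]}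
    (hf : derivative f ≠ 0) (hdeg : 1 < f.natDegree) (hGal : HasAltOrSymGaloisGroup f)
    {L : Type*} [Field L] [Algebra K L] [IsSepClosed L] {α : L} (hα : Transcendental K α)
    (hnormal : @Normal (RatFunc K) L _ _ (evalTranscendental hα).toRingHom.toAlgebra)
    [Fintype (TreeFiber (polyMap L f) α)] [DecidableEq (TreeFiber (polyMap L f) α)]
    (π : Equiv.Perm (TreeFiber (polyMap L f) α)) (hπ : Equiv.Perm.sign π = 1) :
    ∃ σ : L ≃+* L, (∀ a, σ (evalTranscendental hα a) = evalTranscendental hα a) ∧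
      ∀ y : TreeFiber (polyMap L f) α, σ y = π y := by
  let : Algebra (RatFunc K) L := (evalTranscendental hα).toRingHom.toAlgebra
  have hψ (a) : algebraMap (RatFunc K) L a = evalTranscendental hα a := rfl
  have : IsScalarTower K (RatFunc K) L :=
    IsScalarTower.of_algebraMap_eq fun a => ((evalTranscendental hα).commutes a).symm
  have hmap : (overRatFunc f - C RatFunc.X).map (algebraMap (RatFunc K) L) =
      f.map (algebraMap K L) - C α := by
    rw [Polynomial.map_sub, map_C, hψ, evalTranscendental_X, overRatFunc, Polynomial.map_map,
      ← IsScalarTower.algebraMap_eq]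
  have hsep := separable_map_sub_C hf hα
  have hne : overRatFunc f - C RatFunc.X ≠ 0 := fun h => by
    rw [h, Polynomial.map_zero] at hmap
    exact hsep.ne_zero hmap.symm
  let e : TreeFiber (polyMap L f) α ≃ (overRatFunc f - C RatFunc.X).rootSet L :=
    Equiv.subtypeEquivRight fun y => by
      rw [mem_rootSet_of_ne hne, map_sub, aeval_C, hψ, evalTranscendental_X, sub_eq_zero,
        overRatFunc, aeval_map_algebraMap]
      rfl
  obtain ⟨σ, hσ⟩ := exists_algEquiv_of_sign_eq_one (overRatFunc f - C RatFunc.X)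
    (hmap ▸ IsSepClosed.splits_of_separable _ hsep) hdeg hGal (X := TreeFiber (polyMap L f) α) (natCard_fiber hf hα)
    e π hπ
  exact ⟨σ, fun a => σ.commutes a, hσ⟩

/-- Since `t = f^{∘n}(α)`, there is a tower `K(t) ⊆ K(α) ⊆ L` with `K(α)` isomorphic to `K(t)`, and
`L` is normal over `K(α)`. The Galois hypothesis, transported by `t ↦ α`, gives automorphisms fixing
`K(α)`, hence fixing `K(t)`. -/
theorem exists_algEquiv_alternating {K : Type*} [Field K] {f : K[X]}
    (hf : derivative f ≠ 0) (hdeg : 1 < f.natDegree) (hGal : HasAltOrSymGaloisGroup f)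
    {L : Type*} [Field L] [Algebra K L] [Algebra (RatFunc K) L] [IsScalarTower K (RatFunc K) L]
    [IsSepClosed L] [Normal (RatFunc K) L] {n : ℕ} {α : L}
    (hα : α ∈ treeLevel (polyMap L f) (algebraMap (RatFunc K) L RatFunc.X) n)
    [Fintype (TreeFiber (polyMap L f) α)] [DecidableEq (TreeFiber (polyMap L f) α)]
    (π : Equiv.Perm (TreeFiber (polyMap L f) α)) (hπ : Equiv.Perm.sign π = 1) :
    ∃ σ : L ≃ₐ[RatFunc K] L, ∀ y : TreeFiber (polyMap L f) α, σ y = π y := by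
  have htr := transcendental_of_mem_treeLevel transcendental_algebraMap_X hα
  have hpos : 0 < (iteratePoly f n).natDegree := by
    rw [natDegree_iteratePoly]
    exact Nat.pow_pos (by omega)
  have hi : Transcendental K (aeval (RatFunc.X : RatFunc K) (iteratePoly f n)) :=
    RatFunc.transcendental_X.aeval _ hpos.ne' (mem_nonZeroDivisors_of_ne_zero
      (leadingCoeff_ne_zero.2 (ne_zero_of_natDegree_gt hpos)))
  have hcomp : (evalTranscendental htr).comp (evalTranscendental hi) =
      IsScalarTower.toAlgHom K (RatFunc K) L := by
    refine RatFunc.algHom_ext_of_X ?_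
    rw [AlgHom.comp_apply, evalTranscendental_X, ← aeval_algHom_apply, evalTranscendental_X,
      aeval_iteratePoly]
    exact hα
  have hnormal := Normal.of_ringHom_comp (evalTranscendental hi).toRingHom
    (evalTranscendental htr).toRingHom (RingHom.ext fun x => DFunLike.congr_fun hcomp x)
  obtain ⟨σ, hσ, hσ'⟩ := exists_ringEquiv_of_sign_eq_one hf hdeg hGal htr hnormal π hπ
  refine ⟨AlgEquiv.ofRingEquiv (f := σ) fun a => ?_, hσ'⟩
  have h1 : algebraMap (RatFunc K) L a =
      evalTranscendental htr (evalTranscendental hi a) := (DFunLike.congr_fun hcomp a).symm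
  rw [h1, hσ]

/-! ### Square roots of level discriminants. -/

/-- A square root of the discriminant of a finite family, on which permutations act by their
sign. -/
theorem exists_sq_eq_prod_sub {ι L : Type*} [Fintype ι] [DecidableEq ι] [Field L] {v : ι → L}
    (hv : Function.Injective v) : ∃ V : L, V ≠ 0 ∧
      (∃ ε : ℤˣ, V ^ 2 = ((ε : ℤ) : L) * ∏ i, ∏ j ∈ {i}ᶜ, (v i - v j)) ∧
      ∀ (σ : L →+* L) (p : Equiv.Perm ι), (∀ i, σ (v i) = v (p i)) →
        σ V = ((Equiv.Perm.sign p : ℤ) : L) * V := by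
  let e := Fintype.equivFin ι
  let w : Fin (Fintype.card ι) → L := fun i => v (e.symm i)
  have hw : Function.Injective w := hv.comp e.symm.injective
  refine ⟨(Matrix.vandermonde w).det, Matrix.det_vandermonde_ne_zero_iff.2 hw, ?_,
    fun σ p hσ => ?_⟩
  · refine ⟨∏ i : Fin (Fintype.card ι), ∏ j ∈ Finset.Ioi i, -1, ?_⟩
    have h1 := Finset.prod_prod_Ioi_mul_eq_prod_prod_off_diag fun i j => w j - w i
    have h2 : ∏ i, ∏ j ∈ {i}ᶜ, (v i - v j) = ∏ i, ∏ j ∈ {i}ᶜ, (w i - w j) := by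
      refine Fintype.prod_equiv e _ _ fun i => ?_
      refine Finset.prod_equiv e (fun j => by simp) fun j _ => by simp [w]
    rw [h2, ← h1, Matrix.det_vandermonde]
    push_cast
    simp only [← Finset.prod_pow, ← Finset.prod_mul_distrib]
    refine Finset.prod_congr rfl fun i _ => Finset.prod_congr rfl fun j _ => ?_
    ring
  · have h1 : σ.mapMatrix (Matrix.vandermonde w) =
        (Matrix.vandermonde w).submatrix (e.permCongr p) id := by
      ext i j
      simp [Matrix.vandermonde_apply, w, hσ]
    rw [RingHom.map_det, h1, Matrix.det_permute, Equiv.Perm.sign_permCongr]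

theorem aeval_derivative_eq_prod {K L : Type*} [Field K] [Field L] [Algebra K L] [IsSepClosed L]
    {p : K[X]} (hp : derivative p ≠ 0) {α : L} (hα : Transcendental K α)
    [Fintype {y : L // aeval y p = α}] [DecidableEq {y : L // aeval y p = α}]
    (x : {y : L // aeval y p = α}) :
    aeval (x : L) (derivative p) =
      algebraMap K L p.leadingCoeff * ∏ y ∈ {x}ᶜ, ((x : L) - y) := by
  have h1 := congrArg derivative (map_sub_C_eq_prod hp hα)
  have h2 : ∏ y : {y : L // aeval y p = α}, (X - C (y : L)) =
    Lagrange.nodal Finset.univ fun y : {y : L // aeval y p = α} => (y : L) := rfl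
  rw [derivative_sub, derivative_C, sub_zero, derivative_C_mul, h2, derivative_map] at h1
  have h3 := congrArg (eval (x : L)) h1
  rw [eval_map_algebraMap, eval_mul, eval_C,
    Lagrange.eval_nodal_derivative_eval_node_eq (Finset.mem_univ x)] at h3
  rw [h3, Finset.compl_singleton, Lagrange.eval_nodal]

theorem exists_sq_eq_prod_aeval_derivative {K L : Type*} [Field K] [Field L] [Algebra K L]
    [IsSepClosed L] {p : K[X]} (hp : derivative p ≠ 0) {α : L} (hα : Transcendental K α)
    [Fintype {y : L // aeval y p = α}] [DecidableEq {y : L // aeval y p = α}] : ∃ V : L, V ≠ 0 ∧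
      (∃ c : K, c ≠ 0 ∧ V ^ 2 = algebraMap K L c *
        ∏ x : {y : L // aeval y p = α}, aeval (x : L) (derivative p)) ∧
      ∀ (σ : L →+* L) (π : Equiv.Perm {y : L // aeval y p = α}), (∀ i : {y : L // aeval y p = α}, σ i = π i) →
        σ V = ((Equiv.Perm.sign π : ℤ) : L) * V := by
  obtain ⟨V, hV, ⟨ε, hε⟩, hσ⟩ := exists_sq_eq_prod_sub
    (v := fun y : {y : L // aeval y p = α} => (y : L)) Subtype.val_injective
  have hlead : p.leadingCoeff ≠ 0 := leadingCoeff_ne_zero.2 fun h => hp (by rw [h, derivative_zero])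
  refine ⟨V, hV, ⟨((ε : ℤ) : K) *
    (p.leadingCoeff ^ Fintype.card {y : L // aeval y p = α})⁻¹, ?_, ?_⟩, hσ⟩
  · refine mul_ne_zero ?_ (inv_ne_zero (pow_ne_zero _ hlead))
    rcases Int.units_eq_one_or ε with rfl | rfl <;> simp
  · have hlead' : algebraMap K L p.leadingCoeff ≠ 0 := by simpa using hlead
    simp only [aeval_derivative_eq_prod hp hα, Finset.prod_mul_distrib, Finset.prod_const,
      Finset.card_univ]
    rw [hε, map_mul, map_inv₀, map_pow, map_intCast, mul_assoc,
      inv_mul_cancel_left₀ (pow_ne_zero _ hlead')]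

section Level

variable {K : Type*} [Field K] {L : Type*} [Field L] [Algebra K L] [Algebra (RatFunc K) L]
  [IsScalarTower K (RatFunc K) L] {f : K[X]}

theorem algEquiv_aeval (σ : L ≃ₐ[RatFunc K] L) (x : L) (p : K[X]) :
    σ (aeval x p) = aeval (σ x) p := by
  rw [← aeval_map_algebraMap (RatFunc K) x, ← aeval_map_algebraMap (RatFunc K) (σ x)]
  exact (aeval_algHom_apply σ x _).symm

theorem RegularTreeAction.algEquiv_prod_level {d : ℕ} {t : L}
    (h : RegularTreeAction (L ≃ₐ[RatFunc K] L) (polyMap L f) t d) (n : ℕ)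
    [Fintype (treeLevel (polyMap L f) t n)]
    (σ : L ≃ₐ[RatFunc K] L) (p : K[X]) :
    σ (∏ z : treeLevel (polyMap L f) t n, aeval (z : L) p) =
      ∏ z : treeLevel (polyMap L f) t n, aeval (z : L) p := by
  rw [map_prod]
  refine Fintype.prod_equiv (h.levelPerm n σ) _ _ fun z => ?_
  rw [algEquiv_aeval]
  rfl

/-- The discriminant is, up to a constant, the product of `(f^{∘(n+1)})'` over level `n + 1`. The
chain rule splits off the `d`-th power of a Galois-invariant product over level `n`; as `d` is even,
`W` is the Vandermonde determinant divided by the `d/2`-th power of that product. -/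
theorem exists_sq_eq_prod_level [IsSepClosed L] (hf : derivative f ≠ 0)
    (heven : Even f.natDegree) [DecidableEq L]
    {t : L} (ht : Transcendental K t) [∀ n, Fintype (treeLevel (polyMap L f) t n)]
    (h : RegularTreeAction (L ≃ₐ[RatFunc K] L) (polyMap L f) t f.natDegree) (n : ℕ) :
    ∃ W : L, W ≠ 0 ∧ (∃ c : K, c ≠ 0 ∧ W ^ 2 = algebraMap K L c *
      ∏ z : treeLevel (polyMap L f) t (n + 1), aeval (z : L) (derivative f)) ∧
      ∀ σ : L ≃ₐ[RatFunc K] L, σ W = ((h.levelSign n σ : ℤ) : L) * W := by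
  have hP := derivative_iteratePoly_ne_zero hf
  let E : treeLevel (polyMap L f) t (n + 1) ≃ {y : L // aeval y (iteratePoly f (n + 1)) = t} :=
    Equiv.subtypeEquivRight fun y => by rw [treeLevel_eq_setOf]; rfl
  let _ : Fintype {y : L // aeval y (iteratePoly f (n + 1)) = t} := Fintype.ofEquiv _ E
  obtain ⟨V, hV, ⟨c, hc, hVc⟩, hσ⟩ := exists_sq_eq_prod_aeval_derivative (hP (n + 1)) ht
  have hprod : ∏ x : {y : L // aeval y (iteratePoly f (n + 1)) = t},
      aeval (x : L) (derivative (iteratePoly f (n + 1))) =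
      (∏ z : treeLevel (polyMap L f) t (n + 1), aeval (z : L) (derivative f)) *
      (∏ z : treeLevel (polyMap L f) t n, aeval (z : L) (derivative (iteratePoly f n))) ^
        f.natDegree := by
    have h1 (n) (α : treeLevel (polyMap L f) t n) : Finite (TreeFiber (polyMap L f) (α : L)) :=
      finite_treeFiber hf (transcendental_of_mem_treeLevel ht α.2)
    have h2 (n) (α : treeLevel (polyMap L f) t n) : Fintype (TreeFiber (polyMap L f) (α : L)) :=
      Fintype.ofFinite _
    rw [← Equiv.prod_comp E]
    have h3 (x : treeLevel (polyMap L f) t (n + 1)) :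
        aeval (E x : L) (derivative (iteratePoly f (n + 1))) = aeval (x : L) (derivative f) *
        aeval (polyMap L f (x : L)) (derivative (iteratePoly f n)) := by
      rw [derivative_iteratePoly_succ, map_mul, aeval_comp]
      rfl
    simp only [h3, Finset.prod_mul_distrib]
    congr 1
    rw [← Equiv.prod_comp (RegularTreeAction.treeLevelSuccEquiv n), Fintype.prod_sigma,
      ← Finset.prod_pow]
    refine Finset.prod_congr rfl fun α _ => ?_
    rw [Finset.prod_congr rfl (g := fun _ => aeval (α : L) (derivative (iteratePoly f n))),
      Finset.prod_const, Finset.card_univ, ← Nat.card_eq_fintype_card, h.card_fiber n α α.2]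
    intro y _
    exact congrArg (fun z => aeval z (derivative (iteratePoly f n))) y.2
  obtain ⟨k, hk⟩ := heven
  have hB : ∏ z : treeLevel (polyMap L f) t n, aeval (z : L) (derivative (iteratePoly f n)) ≠ 0 :=
    Finset.prod_ne_zero_iff.2 fun z _ => fun h0 =>
      transcendental_of_mem_treeLevel ht z.2 ⟨_, hP n, h0⟩
  have hBk := pow_ne_zero k hB
  refine ⟨V / (∏ z : treeLevel (polyMap L f) t n,
    aeval (z : L) (derivative (iteratePoly f n))) ^ k, div_ne_zero hV hBk, ⟨c, hc, ?_⟩,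
    fun σ => ?_⟩
  · rw [div_pow, hVc, hprod, hk, div_eq_iff (pow_ne_zero 2 hBk)]
    ring
  · rw [map_div₀, map_pow, h.algEquiv_prod_level]
    have h4 := hσ σ (E.permCongr (h.levelPerm (n + 1) σ)) fun i => rfl
    rw [Equiv.Perm.sign_permCongr] at h4
    rw [show σ V = _ from h4, mul_div_assoc]
    rfl

end Level

/-! ### Level discriminants in terms of the critical orbits. -/

/-- The monic polynomial with root multiset `Γ_n`. -/
def criticalPoly {K : Type*} [Field K] (f : K[X]) (n : ℕ) : (AlgebraicClosure K)[X] :=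
  ((criticalImage f n).map fun b => X - C b).prod

theorem roots_criticalPoly {K : Type*} [Field K] (f : K[X]) (n : ℕ) :
    (criticalPoly f n).roots = criticalImage f n :=
  roots_multiset_prod_X_sub_C _

theorem criticalPoly_ne_zero {K : Type*} [Field K] (f : K[X]) (n : ℕ) : criticalPoly f n ≠ 0 :=
  (monic_multisetProd_X_sub_C _).ne_zero

section

variable {K : Type*} [Field K] {L : Type*} [Field L] [Algebra K L] {f : K[X]}
  {Ω : Type*} [Field Ω] [Algebra K Ω] [Algebra L Ω] [IsScalarTower K L Ω]

theorem aeval_derivative_eq_prod_criticalPoints (f : K[X]) (ι : AlgebraicClosure K →ₐ[K] Ω)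
    (x : Ω) : aeval x (derivative f) = algebraMap K Ω (derivative f).leadingCoeff *
      ((criticalPoints f).map fun γ => x - ι γ).prod := by
  have h1 := (IsAlgClosed.splits
    ((derivative f).map (algebraMap K (AlgebraicClosure K)))).eq_prod_roots
  have h2 := congrArg (eval₂ (ι : AlgebraicClosure K →+* Ω) x) h1
  rw [eval₂_map, eval₂_mul, eval₂_C, leadingCoeff_map, eval₂_multiset_prod, Multiset.map_map,
    AlgHom.comp_algebraMap] at h2
  rw [aeval_def, h2]
  congr 1
  · exact ι.commutes _
  · simp [criticalPoints, aroots]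

theorem prod_sub_eq [IsSepClosed L] {p : K[X]} (hp : derivative p ≠ 0) {t : L}
    (ht : Transcendental K t) [Fintype {y : L // aeval y p = t}] :
    ∃ c : K, c ≠ 0 ∧ ∀ x : Ω, ∏ z : {y : L // aeval y p = t}, (algebraMap L Ω z - x) =
      algebraMap K Ω c * (algebraMap L Ω t - aeval x p) := by
  have hlead : p.leadingCoeff ≠ 0 := leadingCoeff_ne_zero.2 fun h => hp (by rw [h, derivative_zero])
  have hlead' : algebraMap K Ω p.leadingCoeff ≠ 0 := by simpa using hlead
  refine ⟨-(-1) ^ Fintype.card {y : L // aeval y p = t} * p.leadingCoeff⁻¹,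
    mul_ne_zero (neg_ne_zero.2 (pow_ne_zero _ (neg_ne_zero.2 one_ne_zero))) (inv_ne_zero hlead),
    fun x => ?_⟩
  have h1 := congrArg (eval₂ (algebraMap L Ω) x) (map_sub_C_eq_prod hp ht)
  rw [eval₂_sub, eval₂_map, eval₂_C, eval₂_mul, eval₂_C, eval₂_finsetProd,
    ← IsScalarTower.algebraMap_eq, ← IsScalarTower.algebraMap_apply, ← aeval_def] at h1
  simp only [eval₂_sub, eval₂_X, eval₂_C] at h1
  have h2 : ∏ z : {y : L // aeval y p = t}, (algebraMap L Ω z - x) =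
      (-1) ^ Fintype.card {y : L // aeval y p = t} *
        ∏ z : {y : L // aeval y p = t}, (x - algebraMap L Ω z) := by
    rw [← Finset.card_univ, ← Finset.prod_const, ← Finset.prod_mul_distrib]
    exact Finset.prod_congr rfl fun z _ => by ring
  rw [h2, ← neg_sub (aeval x p), h1]
  simp only [map_mul, map_neg, map_pow, map_one, map_inv₀]
  field_simp

/-- Factor `f'(z)` over the critical points and exchange the products: for fixed `γ`, the product of
`z - γ` over the level is a constant times `t - f^{∘n}(γ)`. The overfield `Ω` is needed because `L`
need not contain the critical points. -/
theorem prod_level_eq_criticalPoly [IsSepClosed L] (hf : derivative f ≠ 0) {t : L}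
    (ht : Transcendental K t) (n : ℕ) [Fintype (treeLevel (polyMap L f) t n)]
    (ι : AlgebraicClosure K →ₐ[K] Ω) :
    ∃ c : K, c ≠ 0 ∧ algebraMap L Ω
      (∏ z : treeLevel (polyMap L f) t n, aeval (z : L) (derivative f)) =
      algebraMap K Ω c * eval₂ (ι : AlgebraicClosure K →+* Ω) (algebraMap L Ω t)
        (criticalPoly f n) := by
  let E : treeLevel (polyMap L f) t n ≃ {y : L // aeval y (iteratePoly f n) = t} :=
    Equiv.subtypeEquivRight fun y => by rw [treeLevel_eq_setOf]; rfl
  let _ : Fintype {y : L // aeval y (iteratePoly f n) = t} := Fintype.ofEquiv _ E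
  obtain ⟨c, hc, h1⟩ := prod_sub_eq (Ω := Ω) (derivative_iteratePoly_ne_zero hf n) ht
  refine ⟨(derivative f).leadingCoeff ^ Fintype.card (treeLevel (polyMap L f) t n) *
    c ^ Multiset.card (criticalPoints f), mul_ne_zero (pow_ne_zero _ (leadingCoeff_ne_zero.2 hf))
    (pow_ne_zero _ hc), ?_⟩
  have h2 (z : L) : algebraMap L Ω (aeval z (derivative f)) =
      algebraMap K Ω (derivative f).leadingCoeff *
      ((criticalPoints f).map fun γ => algebraMap L Ω z - ι γ).prod := by
    rw [← aeval_derivative_eq_prod_criticalPoints, aeval_algebraMap_apply]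
  have h3 (γ : AlgebraicClosure K) : ∏ z : treeLevel (polyMap L f) t n, (algebraMap L Ω z - ι γ) =
      algebraMap K Ω c * (algebraMap L Ω t -
        ι ((polyMap (AlgebraicClosure K) f)^[n] γ)) := by
    rw [← aeval_iteratePoly, ← aeval_algHom_apply, ← h1, ← Equiv.prod_comp E]
    rfl
  rw [map_prod]
  simp only [h2]
  rw [Finset.prod_mul_distrib, Finset.prod_const, Finset.card_univ, map_mul, map_pow, map_pow,
    mul_assoc, Finset.prod_eq_multiset_prod, Multiset.prod_map_prod_map]
  congr 1
  rw [show Multiset.map (fun γ => (Multiset.map (fun z : treeLevel (polyMap L f) t n =>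
    algebraMap L Ω z - ι γ) Finset.univ.val).prod) (criticalPoints f) = _ from
    Multiset.map_congr rfl fun γ _ => h3 γ, Multiset.prod_map_mul, Multiset.map_const',
    Multiset.prod_replicate, criticalPoly, eval₂_multiset_prod, criticalImage, Multiset.map_map,
    Multiset.map_map]
  congr 2
  refine Multiset.map_congr rfl fun γ _ => ?_
  simp

theorem eval₂_injective_of_transcendental (ι : AlgebraicClosure K →ₐ[K] Ω) {t : Ω}
    (ht : Transcendental K t) :
    Function.Injective (eval₂ (ι : AlgebraicClosure K →+* Ω) t) := by
  let _ : Algebra (AlgebraicClosure K) Ω := ι.toRingHom.toAlgebra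
  have : IsScalarTower K (AlgebraicClosure K) Ω :=
    IsScalarTower.of_algebraMap_eq fun a => (ι.commutes a).symm
  exact transcendental_iff_injective.1 (ht.extendScalars (AlgebraicClosure K))

/-- A relation between level signs makes the product of the corresponding `W i` Galois-invariant,
hence a rational function `r`. Then `r ^ 2` is a constant times the product of the critical
polynomials, whose order at `a` is odd. -/
theorem prod_levelSign_ne [Algebra (RatFunc K) L] [IsScalarTower K (RatFunc K) L]
    [IsSepClosed L] [IsGalois (RatFunc K) L] (hf : derivative f ≠ 0)
    (heven : Even f.natDegree) [DecidableEq L]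
    [∀ n, Fintype (treeLevel (polyMap L f) (algebraMap (RatFunc K) L RatFunc.X) n)]
    (h : RegularTreeAction (L ≃ₐ[RatFunc K] L) (polyMap L f)
      (algebraMap (RatFunc K) L RatFunc.X) f.natDegree) {n : ℕ} {a : AlgebraicClosure K}
    (ha : a ∈ oddCriticalImage f (n + 1)) {E : Finset ℕ}
    (hE : ∀ i ∈ E, a ∉ oddCriticalImage f (i + 1)) :
    ∃ σ, h.levelSign n σ ≠ ∏ i ∈ E, h.levelSign i σ := by
  classical
  by_contra! hcon
  have hnE : n ∉ E := fun hn => hE n hn ha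
  have ht := transcendental_algebraMap_X (K := K) (L := L)
  choose W hW0 hWc hW using exists_sq_eq_prod_level hf heven ht h
  choose c hc0 hWc using hWc
  let ι : AlgebraicClosure K →ₐ[K] AlgebraicClosure L := IsAlgClosed.lift
  have hcrit (m : ℕ) := prod_level_eq_criticalPoly hf ht m ι
  choose c' hc0' hD using hcrit
  set T := algebraMap L (AlgebraicClosure L) (algebraMap (RatFunc K) L RatFunc.X) with hT
  have hTtr : Transcendental K T :=
    (transcendental_algebraMap_iff (algebraMap L (AlgebraicClosure L)).injective).2 ht
  let S := insert n E
  have hfix (σ : L ≃ₐ[RatFunc K] L) : σ (∏ i ∈ S, W i) = ∏ i ∈ S, W i := by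
    have h1 : ∏ i ∈ S, h.levelSign i σ = 1 := by
      rw [Finset.prod_insert hnE, ← hcon σ, Int.units_mul_self]
    have h2 : ∏ i ∈ S, ((h.levelSign i σ : ℤ) : L) = 1 := by
      have := congrArg (fun u : ℤˣ => ((u : ℤ) : L)) h1
      simpa [Units.coe_prod] using this
    rw [map_prod, Finset.prod_congr rfl fun i _ => hW i σ, Finset.prod_mul_distrib, h2, one_mul]
  obtain ⟨r, hr⟩ := IntermediateField.mem_bot.1
    ((InfiniteGalois.mem_bot_iff_fixed (k := RatFunc K) (∏ i ∈ S, W i)).2 hfix)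
  have hpoly (p : K[X]) : algebraMap L (AlgebraicClosure L) (algebraMap (RatFunc K) L
      (algebraMap K[X] (RatFunc K) p)) = eval₂ (ι : AlgebraicClosure K →+* AlgebraicClosure L) T
        (p.map (algebraMap K (AlgebraicClosure K))) := by
    rw [eval₂_map, AlgHom.comp_algebraMap, ← aeval_def, hT, aeval_algebraMap_apply,
      aeval_algebraMap_apply, ← RatFunc.algebraMap_X, aeval_algebraMap_apply, aeval_X_left_apply]
  have hr0 : r ≠ 0 := by
    rintro rfl
    rw [map_zero] at hr
    exact Finset.prod_ne_zero_iff.2 (fun i _ => hW0 i) hr.symm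
  let C₀ : K := ∏ i ∈ S, (c i * c' (i + 1))
  have hC₀ : C₀ ≠ 0 := Finset.prod_ne_zero_iff.2 fun i _ => mul_ne_zero (hc0 i) (hc0' (i + 1))
  have hsq : algebraMap L (AlgebraicClosure L) (algebraMap (RatFunc K) L r) ^ 2 =
      eval₂ (ι : AlgebraicClosure K →+* AlgebraicClosure L) T
        (C (algebraMap K (AlgebraicClosure K) C₀) * ∏ i ∈ S, criticalPoly f (i + 1)) := by
    rw [hr, ← map_pow, ← Finset.prod_pow, Finset.prod_congr rfl fun i _ => hWc i, map_prod,
      eval₂_mul, eval₂_C, eval₂_finsetProd, AlgHom.coe_toRingHom, ι.commutes, map_prod,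
      ← Finset.prod_mul_distrib]
    refine Finset.prod_congr rfl fun i _ => ?_
    rw [map_mul, hD, ← IsScalarTower.algebraMap_apply, map_mul, mul_assoc]
  have hq0 : algebraMap K[X] (RatFunc K) r.denom ≠ 0 := RatFunc.algebraMap_ne_zero r.denom_ne_zero
  have hkey : (r.num.map (algebraMap K (AlgebraicClosure K))) ^ 2 =
      (r.denom.map (algebraMap K (AlgebraicClosure K))) ^ 2 *
      (C (algebraMap K (AlgebraicClosure K) C₀) * ∏ i ∈ S, criticalPoly f (i + 1)) := by
    refine eval₂_injective_of_transcendental ι hTtr ?_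
    rw [eval₂_mul, ← hsq, eval₂_pow, eval₂_pow, ← hpoly, ← hpoly, ← mul_pow, ← map_mul, ← map_mul]
    congr 4
    rw [eq_comm, mul_comm, ← eq_div_iff hq0, r.num_div_denom]
  have hnum : r.num.map (algebraMap K (AlgebraicClosure K)) ≠ 0 :=
    (Polynomial.map_ne_zero_iff (algebraMap K (AlgebraicClosure K)).injective).2
      (RatFunc.num_ne_zero hr0)
  have hne := pow_ne_zero 2 hnum
  rw [hkey] at hne
  -- Multiplicity of `a`: even on the left and in the squared denominator, odd in the factor for `n
  -- + 1`, even in each factor for `E`.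
  have hroots := congrArg (fun p => p.roots.count a) hkey
  rw [roots_mul hne, roots_pow, roots_pow, roots_C_mul _ (by simpa using hC₀),
    roots_prod _ _ (Finset.prod_ne_zero_iff.2 fun i _ => criticalPoly_ne_zero f _),
    Multiset.count_add, Multiset.count_nsmul, Multiset.count_nsmul, Multiset.count_bind] at hroots
  simp only [roots_criticalPoly] at hroots
  change _ = _ + ∑ i ∈ S, (criticalImage f (i + 1)).count a at hroots
  rw [Finset.sum_insert hnE] at hroots
  have hodd : Odd ((criticalImage f (n + 1)).count a) := by
    convert (show Odd _ from ha)
  have hev : Even (∑ i ∈ E, (criticalImage f (i + 1)).count a) :=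
    Finset.even_sum _ fun i hi => by
      have := hE i hi
      rw [oddCriticalImage, Set.mem_ofPred_eq, Nat.not_odd_iff_even] at this
      convert this
  obtain ⟨u, hu⟩ := hodd
  obtain ⟨v, hv⟩ := hev
  omega

end

/-! ### The criterion on odd critical images. -/

theorem hasMaximalMonodromy_of_oddCriticalImage {K : Type*} [Field K] (f : K[X])
    (heven : Even f.natDegree) (hGal : HasAltOrSymGaloisGroup f)
    (hodd : ∀ n : ℕ, 1 ≤ n →
      ¬ oddCriticalImage f n ⊆ ⋃ i ∈ Set.Ico 1 n, oddCriticalImage f i) :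
    HasMaximalMonodromy f := by
  classical
  -- The zero polynomial has the empty root multiset, so a zero derivative would make `Γ'_1` empty.
  have hf : derivative f ≠ 0 := by
    intro h0
    refine hodd 1 le_rfl fun a ha => ?_
    simp [oddCriticalImage, criticalImage, criticalPoints, h0] at ha
  have hdeg : 1 < f.natDegree := by
    obtain ⟨k, hk⟩ := heven
    have := natDegree_pos_of_derivative_ne_zero hf
    omega
  refine ⟨fun n => ?_, fun n hn => ?_, ?_⟩
  · rw [iteratePoly_overRatFunc]
    exact separable_map_sub_C (derivative_iteratePoly_ne_zero hf n) RatFunc.transcendental_X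
  · rw [iteratePoly_overRatFunc, overRatFunc, eval_map_algebraMap, aeval_iteratePoly]
    exact iterate_polyMap_ne hdeg RatFunc.transcendental_X n hn
  · let L := SeparableClosure (RatFunc K)
    have ht := transcendental_algebraMap_X (K := K) (L := L)
    have hfin := finite_treeLevel (L := L) hf ht
    have (n : ℕ) : Fintype (treeLevel (polyMap L f) (algebraMap (RatFunc K) L RatFunc.X) n) :=
      Fintype.ofFinite _
    have hfin' (n : ℕ) (α : treeLevel (polyMap L f) (algebraMap (RatFunc K) L RatFunc.X) n) :
        Finite (TreeFiber (polyMap L f) (α : L)) :=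
      finite_treeFiber hf (transcendental_of_mem_treeLevel ht α.2)
    have (n : ℕ) (α : treeLevel (polyMap L f) (algebraMap (RatFunc K) L RatFunc.X) n) :
        Fintype (TreeFiber (polyMap L f) (α : L)) := Fintype.ofFinite _
    have key : ∃ h : RegularTreeAction (L ≃ₐ[RatFunc K] L) (polyMap L f)
        (algebraMap (RatFunc K) L RatFunc.X) f.natDegree,
        ∀ n, Function.Surjective (h.fiberPerm n) := by
      have h := regularTreeAction_polyMap (L := L) hf heven
      refine ⟨h, h.fiberPerm_surjective
        (fun n α p hp => exists_algEquiv_alternating hf hdeg hGal α.2 p hp) fun n E hE => ?_⟩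
      -- The shift is that of `levelSign n`, which concerns level `n + 1` and so `Γ_{n+1}`.
      obtain ⟨a, ha, ha'⟩ := Set.not_subset.1 (hodd (n + 1) (by omega))
      refine prod_levelSign_ne hf heven h ha fun i hi hmem => ha' ?_
      have := Finset.mem_range.1 (hE hi)
      exact Set.mem_biUnion (show i + 1 ∈ Set.Ico 1 (n + 1) from ⟨by omega, by omega⟩) hmem
    have hper (n : ℕ) (hn : 1 ≤ n) := iterate_polyMap_ne (L := L) hdeg ht n hn
    rw [← polyMap_overRatFunc] at key
    simp only [← polyMap_overRatFunc f] at hper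
    obtain ⟨h, hs⟩ := key
    exact arborealRep_range_eq_top hper h hs

/-! ### Irreducible derivatives of odd degree. -/

/-- The cardinality is the common multiplicity times the number of distinct elements. -/
theorem Multiset.odd_count_of_const {β : Type*} [DecidableEq β] {s : Multiset β}
    (hs : Odd (Multiset.card s)) (hconst : ∀ x ∈ s, ∀ y ∈ s, s.count x = s.count y) {x : β}
    (hx : x ∈ s) : Odd (s.count x) := by
  rw [← Multiset.toFinset_sum_count_eq, Finset.sum_congr rfl fun y hy =>
    hconst y (Multiset.mem_toFinset.1 hy) x hx, Finset.sum_const, smul_eq_mul] at hs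
  exact Nat.Odd.of_mul_right hs

section

variable {k : Type*} [Field k] {g : k[X]}

theorem map_algEquiv_aroots (p : k[X]) (σ : AlgebraicClosure k ≃ₐ[k] AlgebraicClosure k) :
    (p.aroots (AlgebraicClosure k)).map σ = p.aroots (AlgebraicClosure k) := by
  have h := (IsAlgClosed.splits (p.map (algebraMap k (AlgebraicClosure k)))).roots_map
    (σ : AlgebraicClosure k →+* AlgebraicClosure k)
  rw [Polynomial.map_map, show (σ : AlgebraicClosure k →+* AlgebraicClosure k).comp
    (algebraMap k (AlgebraicClosure k)) = algebraMap k (AlgebraicClosure k) from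
    RingHom.ext σ.commutes] at h
  exact h.symm

/-- Automorphisms over `k` permute the roots of `p` transitively, preserve the root multiset and
commute with `g`. Roots are counted with multiplicity, so `p` may be inseparable. -/
theorem count_iterate_aroots_const [DecidableEq (AlgebraicClosure k)]
    {p : k[X]} (hp : Irreducible p) (n : ℕ) :
    ∀ x ∈ (p.aroots (AlgebraicClosure k)).map (polyMap (AlgebraicClosure k) g)^[n],
    ∀ y ∈ (p.aroots (AlgebraicClosure k)).map (polyMap (AlgebraicClosure k) g)^[n],
      ((p.aroots (AlgebraicClosure k)).map (polyMap (AlgebraicClosure k) g)^[n]).count x =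
      ((p.aroots (AlgebraicClosure k)).map (polyMap (AlgebraicClosure k) g)^[n]).count y := by
  intro x hx y hy
  obtain ⟨γ, hγ, rfl⟩ := Multiset.mem_map.1 hx
  obtain ⟨δ, hδ, rfl⟩ := Multiset.mem_map.1 hy
  obtain ⟨σ, hσ⟩ : ∃ σ : AlgebraicClosure k ≃ₐ[k] AlgebraicClosure k, σ γ = δ := by
    refine minpoly.exists_algEquiv_of_root' (Algebra.IsAlgebraic.isAlgebraic γ) ?_
    rw [← minpoly.eq_of_irreducible hp (mem_aroots.1 hγ).2, map_mul, (mem_aroots.1 hδ).2, zero_mul]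
  have hcomm (z) : (polyMap (AlgebraicClosure k) g)^[n] (σ z) =
      σ ((polyMap (AlgebraicClosure k) g)^[n] z) := by
    rw [← aeval_iteratePoly, ← aeval_iteratePoly]
    exact aeval_algHom_apply σ z _
  have hinv : ((p.aroots (AlgebraicClosure k)).map (polyMap (AlgebraicClosure k) g)^[n]).map σ =
      (p.aroots (AlgebraicClosure k)).map (polyMap (AlgebraicClosure k) g)^[n] := by
    conv_rhs => rw [← map_algEquiv_aroots p σ]
    rw [Multiset.map_map, Multiset.map_map]
    exact Multiset.map_congr rfl fun z _ => (hcomm z).symm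
  conv_rhs => rw [← hinv]
  rw [← hσ, hcomm, Multiset.count_map_eq_count' _ _ σ.injective]

theorem iterate_mem_oddCriticalImage {K : Type*} [Field K] [Algebra k K] {f : K[X]}
    (hg : g.map (algebraMap k K) = f) (hirr : Irreducible (derivative g))
    (hodd : Odd (derivative f).natDegree) (n : ℕ) {γ : AlgebraicClosure K}
    (hγ : γ ∈ criticalPoints f) :
    (polyMap (AlgebraicClosure K) f)^[n] γ ∈ oddCriticalImage f n := by
  classical
  let ι : AlgebraicClosure k →ₐ[k] AlgebraicClosure K := IsAlgClosed.lift
  have hΓ : criticalPoints f = ((derivative g).aroots (AlgebraicClosure k)).map ι := by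
    have h := (IsAlgClosed.splits ((derivative g).map
      (algebraMap k (AlgebraicClosure k)))).roots_map (ι : AlgebraicClosure k →+* AlgebraicClosure K)
    rw [Polynomial.map_map, AlgHom.comp_algebraMap] at h
    rw [criticalPoints, ← hg, derivative_map, aroots, Polynomial.map_map,
      ← IsScalarTower.algebraMap_eq, h]
    rfl
  have hcomm (z) : (polyMap (AlgebraicClosure K) f)^[n] (ι z) =
      ι ((polyMap (AlgebraicClosure k) g)^[n] z) := by
    have hfun : polyMap (AlgebraicClosure K) f = polyMap (AlgebraicClosure K) g :=
      funext fun z => by rw [polyMap, ← hg, aeval_map_algebraMap]; rfl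
    rw [hfun, ← aeval_iteratePoly, ← aeval_iteratePoly, aeval_algHom_apply]
  have hΓn : criticalImage f n =
      (((derivative g).aroots (AlgebraicClosure k)).map
        (polyMap (AlgebraicClosure k) g)^[n]).map ι := by
    rw [criticalImage, hΓ, Multiset.map_map, Multiset.map_map]
    exact Multiset.map_congr rfl fun z _ => hcomm z
  rw [hΓ] at hγ
  obtain ⟨z, hz, rfl⟩ := Multiset.mem_map.1 hγ
  have hcard : Odd (Multiset.card (((derivative g).aroots (AlgebraicClosure k)).map
      (polyMap (AlgebraicClosure k) g)^[n])) := by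
    rw [Multiset.card_map, ← (IsAlgClosed.splits _).natDegree_eq_card_roots, natDegree_map]
    rwa [← hg, derivative_map, natDegree_map] at hodd
  have h1 := Multiset.odd_count_of_const hcard (count_iterate_aroots_const hirr n)
    (Multiset.mem_map_of_mem _ hz)
  rw [oddCriticalImage, Set.mem_ofPred_eq, hcomm, hΓn]
  have hinj : Function.Injective ι := ι.toRingHom.injective
  rw [← Multiset.count_map_eq_count' ι _ hinj] at h1
  convert h1

end

/-- The first `n` images of the critical set, starting with the set itself, form a finite set. The
inclusion sends the last of them back into it, so it is stable under `f`. -/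
theorem isPostCriticallyFinite_of_subset {K : Type*} [Field K] {f : K[X]} {n : ℕ} (hn : 1 ≤ n)
    (hmem : ∀ γ ∈ criticalPoints f,
      (polyMap (AlgebraicClosure K) f)^[n] γ ∈ oddCriticalImage f n)
    (hsub : oddCriticalImage f n ⊆ ⋃ i ∈ Set.Ico 1 n, oddCriticalImage f i) :
    IsPostCriticallyFinite f := by
  classical
  set φ := polyMap (AlgebraicClosure K) f with hφ
  let O : Set (AlgebraicClosure K) :=
    ⋃ i ∈ Finset.range n, ((criticalPoints f).toFinset.image φ^[i] : Finset (AlgebraicClosure K))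
  have hO : O.Finite := Set.Finite.biUnion (Finset.finite_toSet _) fun i _ => Finset.finite_toSet _
  have memO {x} : x ∈ O ↔ ∃ i < n, ∃ γ ∈ criticalPoints f, φ^[i] γ = x := by
    simp [O]
  have hmaps : ∀ x ∈ O, φ x ∈ O := by
    intro x hx
    obtain ⟨i, hi, γ, hγ, rfl⟩ := memO.1 hx
    rw [← Function.iterate_succ_apply' φ]
    by_cases hin : i + 1 < n
    · exact memO.2 ⟨i + 1, hin, γ, hγ, rfl⟩
    · obtain rfl : i + 1 = n := by omega
      obtain ⟨j, hj, hodd⟩ := Set.mem_iUnion₂.1 (hsub (hmem γ hγ))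
      have hpos : φ^[i + 1] γ ∈ criticalImage f j :=
        Multiset.count_pos.1 (show Odd _ from hodd).pos
      obtain ⟨δ, hδ, h⟩ := Multiset.mem_map.1 hpos
      exact memO.2 ⟨j, hj.2, δ, hδ, h⟩
  intro γ hγ
  refine hO.subset ?_
  rintro _ ⟨m, rfl⟩
  induction m with
  | zero => exact memO.2 ⟨0, hn, γ, hγ, rfl⟩
  | succ m ih =>
    simp only [Function.iterate_succ_apply']
    exact hmaps _ ih

end

theorem theorem3p1 {K : Type*} [Field K] (f : K[X]) (hdeg : Even f.natDegree)
    (hGal : HasAltOrSymGaloisGroup f) :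
    ((∀ n : ℕ, 1 ≤ n → ¬ oddCriticalImage f n ⊆ ⋃ i ∈ Set.Ico 1 n, oddCriticalImage f i) →
      HasMaximalMonodromy f) ∧
    (∀ (k : Type*) [Field k] [Algebra k K] (g : k[X]), g.map (algebraMap k K) = f →
      Irreducible (derivative g) → Odd (derivative f).natDegree →
      ¬ IsPostCriticallyFinite f → HasMaximalMonodromy f) := by
  refine ⟨hasMaximalMonodromy_of_oddCriticalImage f hdeg hGal, ?_⟩
  intro k _ _ g hg hirr hodd hpcf
  refine hasMaximalMonodromy_of_oddCriticalImage f hdeg hGal fun n hn hsub => hpcf ?_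
  exact isPostCriticallyFinite_of_subset hn
    (fun γ hγ => iterate_mem_oddCriticalImage hg hirr hodd n hγ) hsub
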